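/- **Definitions.** Let $\mathbb U=\bigcup_{h\ge 0}\{1,2,\dots\}^h$ be the set of finite words over the positive integers. A *plane tree* is a non-empty finite set $T\subset\mathbb U$ such that $ui\in T$ (with $u\in\mathbb U$, $i\ge 1$) implies $u\in T$ and $uj\in T$ for all $1\le j\le i$. For $u\in T$ let $k_u(T)$ be the number of $i\ge 1$ with $ui\in T$; $u$ is a *leaf* of $T$ if $k_u(T)=0$. For $d\ge 1$, a *right-leaning bouquet of $d$ leaves* in $T$ is a set of leaves of $T$ of the form $\{ui : k_u(T)-d<i\le k_u(T)\}$ for some $u\in T$ with $k_u(T)\ge d$. A plane tree is a *complete $d$-ary tree* if each of its vertices has $0$ or $d$ children. For a non-negative sequence $\mathbf w=(w_0,w_1,\dots)$ and $n\ge1$, let $\mathbf{SG}^{\mathbf w}_n$ be the probability distribution on plane trees with $n$ vertices for which the probability of $T$ is proportional to $\prod_{u\in T}w_{k_u(T)}$ (if these weights do not all vanish). For a probability measure $\mu$ on $\mathbb Z_+=\{0,1,2,\dots\}$, let $\mathbf{BGW}^\mu_n$ be the Bienaymé–Galton–Watson measure $\mathbf{BGW}^\mu(T)=\prod_{u\in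 T}\mu(k_u(T))$ conditioned on $T$ having $n$ vertices. A non-negative sequence $(x_i)_{i\ge0}$ is *log-concave* if $x_i^2\ge x_{i-1}x_{i+1}$ for all $i\ge1$ and it has no internal zeros, i.e. $x_ix_j\ne0$ with $i<j$ implies $x_k\neq 0$ for all $i\le k\le j$. Say that probability distributions $(\mathcal L_n)_{n\ge 0}$ on plane trees *admit a $d$-bouquet coupling* if there is, on some probability space, a Markov process $(X_n)_{n\ge0}$ of random plane trees such that $X_n$ has law $\mathcal L_n$ for every $n\ge 0$, $X_0\subsetneq X_1\subsetneq X_2\subsetneq\cdots$, and for every $n\ge0$ the set $X_{n+1}\setminus X_n$ is a right-leaning bouquet of $d$ leaves in $X_{n+1}$. **Theorem.** Let $d\ge1$. 1. Let $\mu$ be a probability measure on $\mathbb Z_+$ with $0<\mu(0)<1$ whose support is included in $d\mathbb Z_+$. If $(\mu(kd))_{k\ge0}$ is log-concave, then the distributions $(\mathbf{BGW}^\mu_{nd+1})_{n\ge0}$ are well defined and admit a $d$-bouquet coupling $T_1\subset T_{d+1}\subset T_{2d+1}\subset\cdots$. 2. Let $\mathbf w$ be a non-negative sequence whose support is $\{\ell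 d:0\le\ell\le r\}$ for some $r\in\{1,2,\dots\}\cup\{\infty\}$ (so that $w_0w_d>0$). If $(w_{kd})_{k\ge0}$ is log-concave, then the distributions $(\mathbf{SG}^{\mathbf w}_{nd+1})_{n\ge0}$ are well defined and admit a $d$-bouquet coupling. 3. Suppose $d\ge2$. For $\mu=(1-\frac1d)\delta_0+\frac1d\delta_d$ and every $n\ge0$, $\mathbf{BGW}^\mu_{nd+1}$ is the uniform distribution on complete $d$-ary trees with $nd+1$ vertices (i.e. with $n$ interior vertices). Consequently these uniform distributions, $n\ge0$, admit a $d$-bouquet coupling. -/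

import Mathlib

open MeasureTheory ProbabilityTheory
open scoped ENNReal NNReal

/-- A plane tree in Neveu's formalism: a non-empty finite set of words over `{1, 2, …}` (vertices of
the Ulam–Harris tree) closed under taking parents and under taking siblings to the left. The word
`u ++ [i]` is the `i`-th child of the vertex `u`. -/
@[ext]
structure PlaneTree where
  verts : Finset (List ℕ+)
  nonempty : verts.Nonempty
  closed : ∀ (u : List ℕ+) (i : ℕ+), u ++ [i] ∈ verts → u ∈ verts ∧ ∀ j ≤ i, u ++ [j] ∈ verts

namespace PlaneTree

/-- The number of vertices. -/
def size (T : PlaneTree) : ℕ := T.verts.card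

/-- `k_u(T)`: the number of children of `u` in `T`. -/
noncomputable def numChildren (T : PlaneTree) (u : List ℕ+) : ℕ :=
  {i : ℕ+ | u ++ [i] ∈ T.verts}.ncard

/-- A leaf of `T` is a vertex of `T` with no children in `T`. -/
def IsLeaf (T : PlaneTree) (u : List ℕ+) : Prop := u ∈ T.verts ∧ T.numChildren u = 0

/-- `B` is a right-leaning bouquet of `d` leaves in `T`: for some vertex `u` of `T` with at least `d`
children, `B` consists of the `d` rightmost children of `u`, namely the `u ++ [i]` with
`k_u(T) - d < i ≤ k_u(T)`, and all of them are leaves of `T`. -/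
def IsRightLeaningBouquet (d : ℕ) (T : PlaneTree) (B : Set (List ℕ+)) : Prop :=
  ∃ u ∈ T.verts, d ≤ T.numChildren u ∧
    B = {v | ∃ i : ℕ+, T.numChildren u < (i : ℕ) + d ∧ (i : ℕ) ≤ T.numChildren u ∧ v = u ++ [i]} ∧
    ∀ v ∈ B, T.IsLeaf v

/-- Every vertex has either `d` or `0` children. -/
def IsCompleteDary (d : ℕ) (T : PlaneTree) : Prop :=
  ∀ u ∈ T.verts, T.numChildren u = d ∨ T.numChildren u = 0

/-- The (countable) set of plane trees carries the discrete σ-algebra. -/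
instance : MeasurableSpace PlaneTree := ⊤

/-- The weight `∏_{u ∈ T} w(k_u(T))` of a plane tree. -/
noncomputable def weight (w : ℕ → ℝ≥0∞) (T : PlaneTree) : ℝ≥0∞ :=
  ∏ u ∈ T.verts, w (T.numChildren u)

/-- The measure on plane trees that gives each tree `T` the mass `∏_{u ∈ T} w(k_u(T))`. -/
noncomputable def weightMeasure (w : ℕ → ℝ≥0∞) : Measure PlaneTree :=
  Measure.sum fun T => weight w T • Measure.dirac T

/-- The Bienaymé–Galton–Watson measure with offspring distribution `μ`. -/
noncomputable def bgw (μ : Measure ℕ) : Measure PlaneTree :=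
  weightMeasure fun k => μ {k}

/-- The Bienaymé–Galton–Watson measure conditioned on having `n` vertices. -/
noncomputable def bgwCond (μ : Measure ℕ) (n : ℕ) : Measure PlaneTree :=
  (bgw μ)[|{T | T.size = n}]

/-- The law of the simply generated tree with `n` vertices and weight sequence `w`: each tree with
`n` vertices has probability its weight divided by the total weight of the trees with `n`
vertices. -/
noncomputable def simplyGenerated (w : ℕ → ℝ≥0) (n : ℕ) : Measure PlaneTree :=
  (weightMeasure fun k => (w k : ℝ≥0∞))[|{T | T.size = n}]

end PlaneTree

/-- Log-concavity of a sequence: non-negativity, the quadratic inequalities, and no internal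
zeros. -/
def IsLogConcaveSeq (x : ℕ → ℝ) : Prop :=
  (∀ i, 0 ≤ x i) ∧
  (∀ i, x i * x (i + 2) ≤ x (i + 1) ^ 2) ∧
  ∀ i j, i < j → x i * x j ≠ 0 → ∀ k, i ≤ k → k ≤ j → x k ≠ 0

/-- The support of `w` is `{ℓ d : 0 ≤ ℓ ≤ r}` for some `r ∈ {1, 2, …} ∪ {∞}`. -/
def IsArithmeticSeq (d : ℕ) (w : ℕ → ℝ≥0) : Prop :=
  ∃ r : ℕ∞, 1 ≤ r ∧ Function.support w = {k | ∃ l : ℕ, (l : ℕ∞) ≤ r ∧ k = l * d}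

/-- The (elementary) Markov property of a process indexed by `ℕ` with values in a countable space:
given the whole past, provided it has positive probability, the next state depends only on the
present one. -/
def IsMarkovChain {Ω S : Type*} [MeasurableSpace Ω] (P : Measure Ω) (X : ℕ → Ω → S) : Prop :=
  ∀ (n : ℕ) (x : ℕ → S) (y : S), P {ω | ∀ i ≤ n, X i ω = x i} ≠ 0 →
    P[{ω | X (n + 1) ω = y} | {ω | ∀ i ≤ n, X i ω = x i}] =
      P[{ω | X (n + 1) ω = y} | {ω | X n ω = x n}]

/-- The laws `L 0, L 1, L 2, …` on plane trees can be coupled as a Markov process which is increasing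
for inclusion and which adds a right-leaning bouquet of `d` leaves at each step. -/
def HasBouquetCoupling (d : ℕ) (L : ℕ → Measure PlaneTree) : Prop :=
  ∃ (Ω : Type) (_ : MeasurableSpace Ω) (P : Measure Ω) (X : ℕ → Ω → PlaneTree),
    IsProbabilityMeasure P ∧
    (∀ n, Measurable (X n)) ∧
    (∀ n, P.map (X n) = L n) ∧
    IsMarkovChain P X ∧
    ∀ ω n, (X n ω).verts ⊂ (X (n + 1) ω).verts ∧
      (X (n + 1) ω).IsRightLeaningBouquet d
        (((X (n + 1) ω).verts : Set (List ℕ+)) \ ((X n ω).verts : Set (List ℕ+)))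

/-- The offspring distribution `(1 - 1/d) δ₀ + (1/d) δ_d`. -/
noncomputable def daryOffspring (d : ℕ) : Measure ℕ :=
  (1 - (d : ℝ≥0∞)⁻¹) • Measure.dirac 0 + (d : ℝ≥0∞)⁻¹ • Measure.dirac d

/-! Count bouquets instead of vertices: a tree of non-zero weight with `n` bouquets has `n * d + 1`
vertices. More generally, consider what remains of a tree to the right of a given place: `l` forced
further children of a vertex with `o` children so far, then possibly more batches of `d` children,
with `n` bouquets to distribute over all this (`PForest.law`). Given how `n` is split between the
first tree and the rest, these two parts are independent. If the splits of `n` and of `n + 1` can be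
coupled so that exactly one coordinate increases, and by one, then induction places the new bouquet
inside that part and leaves the other part unchanged (`PForest.relCoupled_law`). When neither a
forced child nor a bouquet is left, the new bouquet is attached at the right end, hence it is
right-leaning.

Such a coupling of splits exists as soon as both coordinates are stochastically increasing in `n`:
the distribution functions then interlace and the quantile coupling works (`exists_split_coupling`).

The monotonicity comes from total positivity. Explore a part vertex by vertex: it contains more than
`j` bouquets exactly when its exploration is still alive after a fixed number of vertices. If `e`
bouquets have been seen by then, the remaining forest has a number of vertices that depends on `n`
but not on `e`. The probability of the tail is thus a ratio of two sums over `e`, with the same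
weights for the future, and with past weights `A e` (killed at the end of the part) above and `B e`
(killed at the end of the whole) below. Log-concavity makes the kernel of the future totally
positive of order two (`lrOrder_vertexWeight`) and puts `A` above `B` in likelihood ratio order
(`lrOrder_killedWalk_succ`, `lrOrder_conv_killedWalk`). By the composition formula
`sum_mul_sum_le_of_lrOrder` the ratio increases with `n`.

The couplings of consecutive sizes are then glued into a Markov chain. For the uniform `d`-ary
trees, the offspring law agrees on its support with a geometric weight, which depends on the size of
the tree only. -/

/-! ### Log-concave sequences and the likelihood ratio order -/

/-- The likelihood ratio order on sequences: `B` lies below `A`. -/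
def LROrder (A B : ℕ → ℝ) : Prop := ∀ i j, i < j → A i * B j ≤ A j * B i

/-- The Cauchy product of two sequences. -/
def conv (f g : ℕ → ℝ) (n : ℕ) : ℝ := ∑ p ∈ Finset.HasAntidiagonal.antidiagonal n, f p.1 * g p.2

/-- The monotonicity form of log-concavity. -/
def RatioDecreasing (a : ℕ → ℝ) : Prop := ∀ i j s, i ≤ j → a i * a (j + s) ≤ a (i + s) * a j

theorem conv_nonneg {f g : ℕ → ℝ} (hf : ∀ n, 0 ≤ f n) (hg : ∀ n, 0 ≤ g n) (n : ℕ) :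
    0 ≤ conv f g n :=
  Finset.sum_nonneg fun p _ => mul_nonneg (hf p.1) (hg p.2)

theorem conv_eq_coeff (f g : ℕ → ℝ) (n : ℕ) :
    conv f g n = PowerSeries.coeff n (PowerSeries.mk f * PowerSeries.mk g) := by
  simp [conv, PowerSeries.coeff_mul]

theorem mk_conv (f g : ℕ → ℝ) :
    PowerSeries.mk (conv f g) = PowerSeries.mk f * PowerSeries.mk g := by
  ext n
  simp [conv, PowerSeries.coeff_mul]

theorem conv_comm (f g : ℕ → ℝ) : conv f g = conv g f := by
  funext n
  rw [conv_eq_coeff, mul_comm, ← conv_eq_coeff]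

theorem conv_assoc (f g h : ℕ → ℝ) : conv (conv f g) h = conv f (conv g h) := by
  funext n
  rw [conv_eq_coeff, conv_eq_coeff, mk_conv, mk_conv, mul_assoc]

theorem conv_add (f g h : ℕ → ℝ) : conv f (g + h) = conv f g + conv f h := by
  funext n
  simp [conv, mul_add, Finset.sum_add_distrib]

/-- The ratios of consecutive terms decrease along the support, which is an interval. Both
inductions multiply inequalities and cancel a factor; its positivity is where the absence of
internal zeros is used. -/
theorem IsLogConcaveSeq.ratioDecreasing {x : ℕ → ℝ} (hx : IsLogConcaveSeq x) :
    RatioDecreasing x := by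
  obtain ⟨h0, h1, h2⟩ := hx
  have step : ∀ k i, x i * x (i + k + 1) ≤ x (i + 1) * x (i + k) := by
    intro k
    induction k with
    | zero => intro i; simp [mul_comm]
    | succ k ih =>
      intro i
      by_cases hz : x i * x (i + (k + 1) + 1) = 0
      · rw [hz]; exact mul_nonneg (h0 _) (h0 _)
      have hne := h2 i (i + (k + 1) + 1) (by omega) hz
      have p1 : 0 < x (i + 1) := (h0 _).lt_of_ne' (hne (i + 1) (by omega) (by omega))
      have a1 := h1 i
      have a2 := ih (i + 1)
      rw [show i + 1 + k + 1 = i + (k + 1) + 1 by ring, show i + 1 + k = i + (k + 1) by ring,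
        show i + 1 + 1 = i + 2 by ring] at a2
      have a3 : x (i + 1) * (x i * x (i + (k + 1) + 1)) ≤
          x (i + 1) * (x (i + 1) * x (i + (k + 1))) := by
        calc x (i + 1) * (x i * x (i + (k + 1) + 1))
            = x i * (x (i + 1) * x (i + (k + 1) + 1)) := by ring
          _ ≤ x i * (x (i + 2) * x (i + (k + 1))) := mul_le_mul_of_nonneg_left a2 (h0 _)
          _ = (x i * x (i + 2)) * x (i + (k + 1)) := by ring
          _ ≤ x (i + 1) ^ 2 * x (i + (k + 1)) := mul_le_mul_of_nonneg_right a1 (h0 _)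
          _ = _ := by ring
      exact le_of_mul_le_mul_left a3 p1
  intro i j s hij
  induction s with
  | zero => simp
  | succ s ih =>
    obtain ⟨k, rfl⟩ := Nat.exists_eq_add_of_le hij
    by_cases hz : x i * x (i + k + (s + 1)) = 0
    · rw [hz]; exact mul_nonneg (h0 _) (h0 _)
    have hne := h2 i (i + k + (s + 1)) (by omega) hz
    have p1 : 0 < x (i + s) := (h0 _).lt_of_ne' (hne (i + s) (by omega) (by omega))
    have a2 := step k (i + s)
    rw [show i + s + k + 1 = i + k + (s + 1) by ring, show i + s + k = i + k + s by ring,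
      show i + s + 1 = i + (s + 1) by ring] at a2
    have a3 : x (i + s) * (x i * x (i + k + (s + 1))) ≤
        x (i + s) * (x (i + (s + 1)) * x (i + k)) := by
      calc x (i + s) * (x i * x (i + k + (s + 1)))
          = x i * (x (i + s) * x (i + k + (s + 1))) := by ring
        _ ≤ x i * (x (i + (s + 1)) * x (i + k + s)) := mul_le_mul_of_nonneg_left a2 (h0 _)
        _ = x (i + (s + 1)) * (x i * x (i + k + s)) := by ring
        _ ≤ x (i + (s + 1)) * (x (i + s) * x (i + k)) := mul_le_mul_of_nonneg_left ih (h0 _)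
        _ = _ := by ring
    exact le_of_mul_le_mul_left a3 p1

theorem RatioDecreasing.shift {a : ℕ → ℝ} (ha : RatioDecreasing a) (j : ℕ) :
    RatioDecreasing fun e => a (j + e) := by
  intro i k s hik
  have := ha (j + i) (j + k) s (by omega)
  simpa [add_assoc] using this

/-- The basic composition formula for totally positive kernels of order two. -/
theorem sum_mul_sum_le_of_lrOrder (N : ℕ) {x y A B : ℕ → ℝ}
    (hxy : ∀ p q, p < q → q < N → x q * y p ≤ x p * y q) (hAB : LROrder A B) :
    (∑ p ∈ Finset.range N, x p * A p) * (∑ q ∈ Finset.range N, y q * B q) ≤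
      (∑ p ∈ Finset.range N, y p * A p) * (∑ q ∈ Finset.range N, x q * B q) := by
  -- Symmetrization: twice the difference of the two sides is a double sum of products of a minor of
  -- `(x, y)` and a minor of `(A, B)`, which have opposite signs.
  have key : ∑ p ∈ Finset.range N, ∑ q ∈ Finset.range N,
      (x p * y q - x q * y p) * (A p * B q - A q * B p) ≤ 0 := by
    refine Finset.sum_nonpos fun p hp => Finset.sum_nonpos fun q hq => ?_
    rw [Finset.mem_range] at hp hq
    rcases lt_trichotomy p q with h | rfl | h
    · exact mul_nonpos_of_nonneg_of_nonpos (by linarith [hxy p q h hq]) (by linarith [hAB p q h])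
    · simp
    · exact mul_nonpos_of_nonpos_of_nonneg (by linarith [hxy q p h hp]) (by linarith [hAB q p h])
  have e1 : ∑ p ∈ Finset.range N, ∑ q ∈ Finset.range N,
      (x p * y q - x q * y p) * (A p * B q - A q * B p) =
      2 * ((∑ p ∈ Finset.range N, x p * A p) * (∑ q ∈ Finset.range N, y q * B q)) -
      2 * ((∑ p ∈ Finset.range N, y p * A p) * (∑ q ∈ Finset.range N, x q * B q)) := by
    have h1 : ∀ p q, (x p * y q - x q * y p) * (A p * B q - A q * B p) =
        ((x p * A p) * (y q * B q) + (y p * B p) * (x q * A q)) -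
        ((x p * B p) * (y q * A q) + (y p * A p) * (x q * B q)) := fun p q => by ring
    simp only [h1, Finset.sum_sub_distrib, Finset.sum_add_distrib, ← Finset.sum_mul_sum]
    ring
  linarith

theorem conv_eq_sum_range {a A : ℕ → ℝ} {N n : ℕ} (h : n < N) :
    conv a A n = ∑ p ∈ Finset.range N, (if p ≤ n then a (n - p) else 0) * A p := by
  rw [conv_comm, conv, Finset.Nat.sum_antidiagonal_eq_sum_range_succ (fun i j => A i * a j)]
  rw [← Finset.sum_subset (Finset.range_subset_range.2 (Nat.succ_le_of_lt h))]
  · refine Finset.sum_congr rfl fun p hp => ?_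
    rw [if_pos (Nat.lt_succ_iff.1 (Finset.mem_range.1 hp)), mul_comm]
  · intro p _ hp
    rw [if_neg (by simpa using hp), zero_mul]

theorem LROrder.refl (a : ℕ → ℝ) : LROrder a a := fun i j _ => by rw [mul_comm]

/-- Log-concavity says that the kernel `a (n - p)` is totally positive of order two, so the
composition formula applies. -/
theorem LROrder.conv {a A B : ℕ → ℝ} (ha : RatioDecreasing a) (ha0 : ∀ n, 0 ≤ a n)
    (h : LROrder A B) : LROrder (conv a A) (conv a B) := by
  intro i j hij
  have hi : i < j + 1 := by omega
  rw [conv_eq_sum_range hi, conv_eq_sum_range (Nat.lt_succ_self j),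
    conv_eq_sum_range (Nat.lt_succ_self j), conv_eq_sum_range hi]
  refine sum_mul_sum_le_of_lrOrder (j + 1) (fun p q hpq hq => ?_) h
  have hq' : q ≤ j := Nat.lt_succ_iff.1 hq
  have hp' : p ≤ j := by omega
  rw [if_pos hq', if_pos hp']
  by_cases hqi : q ≤ i
  · rw [if_pos hqi, if_pos (by omega : p ≤ i)]
    have := ha (i - q) (j - q) (q - p) (by omega)
    rwa [show j - q + (q - p) = j - p by omega, show i - q + (q - p) = i - p by omega] at this
  · rw [if_neg hqi, zero_mul]
    exact mul_nonneg (by split_ifs <;> simp [ha0]) (ha0 _)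

/-- Restricting the upper sequence to a smaller up-set only pushes it further up. -/
theorem LROrder.trunc {A B : ℕ → ℝ} (h : LROrder A B) (hA : ∀ n, 0 ≤ A n) (hB : ∀ n, 0 ≤ B n)
    {P Q : ℕ → Prop} [DecidablePred P] [DecidablePred Q]
    (hP : ∀ i j, i ≤ j → P i → P j) (hPQ : ∀ i, P i → Q i) :
    LROrder (fun e => if P e then A e else 0) (fun e => if Q e then B e else 0) := by
  intro i j hij
  dsimp only
  by_cases hi : P i
  · have hj := hP i j hij.le hi
    rw [if_pos hi, if_pos hj, if_pos (hPQ _ hi), if_pos (hPQ _ hj)]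
    exact h i j hij
  · rw [if_neg hi, zero_mul]
    exact mul_nonneg (by split_ifs <;> simp [hA]) (by split_ifs <;> simp [hB])

/-- Where `X` is positive, `(X - Y) / b` is the product of `1 - Y / X` and `X / b`, both of which
increase. Used to remove from a walk the mass that gets killed. -/
theorem LROrder.sub {X Y b : ℕ → ℝ} (hXY : LROrder X Y) (hXb : LROrder X b)
    (hY : ∀ n, 0 ≤ Y n) (hYX : ∀ n, Y n ≤ X n) (hb : ∀ n, 0 ≤ b n) :
    LROrder (fun n => X n - Y n) b := by
  intro i j hij
  dsimp only
  have h1 := hXY i j hij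
  have h2 := hXb i j hij
  rcases ((hY i).trans (hYX i)).eq_or_lt with h0 | h0
  · have : X i - Y i ≤ 0 := by linarith [hY i]
    exact (mul_nonpos_of_nonpos_of_nonneg this (hb j)).trans
      (mul_nonneg (by linarith [hYX j]) (hb i))
  · refine le_of_mul_le_mul_left ?_ h0
    calc X i * ((X i - Y i) * b j) = (X i - Y i) * (X i * b j) := by ring
      _ ≤ (X i - Y i) * (X j * b i) := mul_le_mul_of_nonneg_left h2 (by linarith [hYX i])
      _ = (X i * X j - X j * Y i) * b i := by ring
      _ ≤ (X i * X j - X i * Y j) * b i := mul_le_mul_of_nonneg_right (by linarith) (hb i)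
      _ = _ := by ring

/-! ### Rearrangement of sums over antidiagonals -/

open Finset.HasAntidiagonal in
theorem sum_antidiagonal_assoc (n : ℕ) (f : ℕ → ℕ → ℕ → ℝ) :
    ∑ p ∈ antidiagonal n, ∑ q ∈ antidiagonal p.2, f p.1 q.1 q.2 =
      ∑ p ∈ antidiagonal n, ∑ q ∈ antidiagonal p.1, f q.1 q.2 p.2 := by
  rw [Finset.sum_sigma', Finset.sum_sigma']
  refine Finset.sum_nbij' (fun x => ⟨(x.1.1 + x.2.1, x.2.2), (x.1.1, x.2.1)⟩)
    (fun x => ⟨(x.2.1, x.2.2 + x.1.2), (x.2.2, x.1.2)⟩) ?_ ?_ ?_ ?_ ?_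
  all_goals
    simp only [Finset.mem_sigma, mem_antidiagonal, Sigma.forall, Prod.forall, Sigma.mk.injEq,
      Prod.mk.injEq]
  all_goals intros
  all_goals try simp_all
  all_goals omega

open Finset.HasAntidiagonal in
theorem sum_antidiagonal_interchange (n : ℕ) (f : ℕ → ℕ → ℕ → ℕ → ℝ) :
    ∑ p ∈ antidiagonal n, ∑ q ∈ antidiagonal p.1, ∑ r ∈ antidiagonal p.2, f q.1 q.2 r.1 r.2 =
      ∑ p ∈ antidiagonal n, ∑ q ∈ antidiagonal p.1, ∑ r ∈ antidiagonal p.2,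
        f q.1 r.1 q.2 r.2 := by
  simp only [Finset.sum_sigma']
  refine Finset.sum_nbij'
    (fun x => ⟨(x.2.1.1 + x.2.2.1, x.2.1.2 + x.2.2.2), (x.2.1.1, x.2.2.1), (x.2.1.2, x.2.2.2)⟩)
    (fun x => ⟨(x.2.1.1 + x.2.2.1, x.2.1.2 + x.2.2.2), (x.2.1.1, x.2.2.1), (x.2.1.2, x.2.2.2)⟩)
    ?_ ?_ ?_ ?_ ?_
  all_goals
    simp only [Finset.mem_sigma, mem_antidiagonal, Sigma.forall, Prod.forall, Sigma.mk.injEq,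
      Prod.mk.injEq]
  all_goals intros
  all_goals try simp_all
  all_goals omega

/-! ### Weights of forests by number of bouquets -/

/-- The total weight of the plane forests of `y` trees, all of whose degrees are multiples of `d`,
with `n` bouquets of `d` children in total, when a vertex of degree `k * d` has weight `a k`. -/
noncomputable def forestWeight (a : ℕ → ℝ) (d : ℕ) : ℕ → ℕ → ℝ
  | 0, n => if n = 0 then 1 else 0
  | y + 1, n => ∑ k : Fin (n + 1), a k * forestWeight a d (y + k * d) (n - k)
termination_by y n => y + n * d
decreasing_by
  have h := Nat.lt_succ_iff.1 k.2
  have : k * d + (n - k) * d = n * d := by rw [← add_mul]; congr 1; omega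
  omega

section ForestWeight

open Finset.HasAntidiagonal

variable {a : ℕ → ℝ} {d : ℕ}

theorem forestWeight_zero (n : ℕ) : forestWeight a d 0 n = if n = 0 then 1 else 0 := by
  rw [forestWeight]

theorem forestWeight_succ (y n : ℕ) : forestWeight a d (y + 1) n =
    ∑ p ∈ antidiagonal n, a p.1 * forestWeight a d (y + p.1 * d) p.2 := by
  rw [forestWeight, Finset.Nat.sum_antidiagonal_eq_sum_range_succ
    (fun i j => a i * forestWeight a d (y + i * d) j), Finset.sum_range]

/-- The induction is on the number `y + n * d` of vertices: removing a root with `k * d` children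
lowers it by one. -/
theorem forestWeight_induction {P : ℕ → ℕ → Prop} (zero : ∀ n, P 0 n)
    (succ : ∀ y n, (∀ k r, k + r = n → P (y + k * d) r) → P (y + 1) n) (y n : ℕ) : P y n := by
  suffices h : ∀ N y n, y + n * d = N → P y n from h _ y n rfl
  intro N
  induction N using Nat.strong_induction_on with
  | _ N ih =>
    intro y n hN
    cases y with
    | zero => exact zero n
    | succ y =>
      refine succ y n fun k r hkr => ih (y + k * d + r * d) ?_ _ _ rfl
      subst hkr
      rw [← hN, add_mul]
      omega

theorem forestWeight_nonneg (ha : ∀ k, 0 ≤ a k) (y n : ℕ) : 0 ≤ forestWeight a d y n := by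
  refine forestWeight_induction (d := d) (P := fun y n => 0 ≤ forestWeight a d y n)
    (fun n => ?_) (fun y n ih => ?_) y n
  · rw [forestWeight_zero]; split_ifs <;> simp
  · rw [forestWeight_succ]
    exact Finset.sum_nonneg fun p hp => mul_nonneg (ha _) (ih _ _ (mem_antidiagonal.1 hp))

theorem forestWeight_add (y y' n : ℕ) : forestWeight a d (y + y') n =
    ∑ p ∈ antidiagonal n, forestWeight a d y p.1 * forestWeight a d y' p.2 := by
  refine forestWeight_induction (d := d) (P := fun y n => forestWeight a d (y + y') n =
    ∑ p ∈ antidiagonal n, forestWeight a d y p.1 * forestWeight a d y' p.2)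
    (fun n => ?_) (fun y n ih => ?_) y n
  · rw [Finset.sum_eq_single (0, n)]
    · simp [forestWeight_zero]
    · rintro ⟨i, j⟩ hp hne
      have : i ≠ 0 := by rintro rfl; simp_all
      simp [forestWeight_zero, this]
    · simp
  · rw [show y + 1 + y' = y + y' + 1 by ring, forestWeight_succ]
    simp only [forestWeight_succ, Finset.sum_mul]
    rw [← sum_antidiagonal_assoc n fun k i j =>
      a k * forestWeight a d (y + k * d) i * forestWeight a d y' j]
    refine Finset.sum_congr rfl fun p hp => ?_
    rw [show y + y' + p.1 * d = y + p.1 * d + y' by ring, ih _ _ (mem_antidiagonal.1 hp),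
      Finset.mul_sum]
    simp only [mul_assoc]

/-- The weights of the forests with `T` vertices, by number of bouquets. -/
noncomputable def vertexWeight (a : ℕ → ℝ) (d T n : ℕ) : ℝ :=
  if n * d ≤ T then forestWeight a d (T - n * d) n else 0

/-- The right shift of a sequence. -/
def shiftRight (A : ℕ → ℝ) : ℕ → ℝ
  | 0 => 0
  | n + 1 => A n

theorem shiftRight_nonneg {A : ℕ → ℝ} (hA : ∀ n, 0 ≤ A n) (n : ℕ) : 0 ≤ shiftRight A n := by
  cases n with
  | zero => exact le_rfl
  | succ n => exact hA n

theorem vertexWeight_nonneg (ha : ∀ k, 0 ≤ a k) (T n : ℕ) : 0 ≤ vertexWeight a d T n := by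
  unfold vertexWeight
  split_ifs
  exacts [forestWeight_nonneg ha _ _, le_rfl]

/-- Once the number of vertices is fixed, removing the first root is a plain convolution with `a`.
The inequality is strict because at `n * d = T + 1` no tree is left to carry the `n` bouquets. -/
theorem vertexWeight_succ (T n : ℕ) : vertexWeight a d (T + 1) n =
    if n * d < T + 1 then conv a (vertexWeight a d T) n else 0 := by
  unfold vertexWeight
  rcases lt_trichotomy (n * d) (T + 1) with h | h | h
  · rw [if_pos h.le, if_pos h, show T + 1 - n * d = (T - n * d) + 1 by omega, forestWeight_succ,
      conv]
    refine Finset.sum_congr rfl fun p hp => ?_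
    have hp := mem_antidiagonal.1 hp
    have : p.1 * d + p.2 * d = n * d := by rw [← add_mul, hp]
    rw [if_pos (by omega), show T - p.2 * d = T - n * d + p.1 * d by omega]
  · have hn : n ≠ 0 := by rintro rfl; omega
    rw [if_pos h.le, if_neg (by omega), h, Nat.sub_self, forestWeight_zero, if_neg hn]
  · rw [if_neg (by omega), if_neg (by omega)]

theorem conv_shiftRight (a A : ℕ → ℝ) : conv a (shiftRight A) = shiftRight (conv a A) := by
  funext n
  cases n with
  | zero => simp [conv, shiftRight]
  | succ n =>
    rw [conv, Finset.Nat.sum_antidiagonal_succ']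
    simp [shiftRight, conv]

theorem shiftRight_vertexWeight_succ (T n : ℕ) :
    shiftRight (vertexWeight a d (T + 1)) n =
      if n * d < T + d + 1 then conv a (shiftRight (vertexWeight a d T)) n else 0 := by
  rw [conv_shiftRight]
  cases n with
  | zero => simp [shiftRight]
  | succ n =>
    simp only [shiftRight]
    rw [vertexWeight_succ, add_mul, one_mul]
    congr 1
    simp only [eq_iff_iff]
    omega

/-- Adding one bouquet means adding `d` vertices. After the shift both sequences obey the same
recursion in `T`, a convolution with `a` followed by the same truncation, so the order propagates
from `T = 0`, where the lower sequence lives at `0` only. -/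
theorem lrOrder_vertexWeight (hd : 1 ≤ d) (ha : RatioDecreasing a) (ha0 : ∀ k, 0 ≤ a k) (T : ℕ) :
    LROrder (shiftRight (vertexWeight a d T)) (vertexWeight a d (T + d)) := by
  induction T with
  | zero =>
    intro i j hij
    have h0 : 0 ≤ shiftRight (vertexWeight a d 0) j * vertexWeight a d (0 + d) i :=
      mul_nonneg (shiftRight_nonneg (vertexWeight_nonneg ha0 _) _) (vertexWeight_nonneg ha0 _ _)
    have hj : vertexWeight a d (0 + d) j = 0 := by
      obtain ⟨e, rfl⟩ : ∃ e, d = e + 1 := ⟨d - 1, by omega⟩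
      rw [zero_add, vertexWeight_succ, if_neg]
      have := Nat.mul_le_mul_right (e + 1) (by omega : 1 ≤ j)
      omega
    rw [hj, mul_zero]
    exact h0
  | succ T ih =>
    have e1 : shiftRight (vertexWeight a d (T + 1)) = fun n =>
      if n * d < T + d + 1 then conv a (shiftRight (vertexWeight a d T)) n else 0 :=
      funext fun n => shiftRight_vertexWeight_succ T n
    have e2 : vertexWeight a d (T + 1 + d) = fun n =>
      if n * d < T + d + 1 then conv a (vertexWeight a d (T + d)) n else 0 := by
      rw [show T + 1 + d = T + d + 1 by ring]
      exact funext fun n => vertexWeight_succ (T + d) n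
    rw [e1, e2]
    have h := ih.conv ha ha0
    intro i j hij
    dsimp only
    by_cases hj : j * d < T + d + 1
    · have : i * d ≤ j * d := Nat.mul_le_mul_right d hij.le
      rw [if_pos hj, if_pos hj, if_pos (by omega), if_pos (by omega)]
      exact h i j hij
    · simp [hj]

/-! ### Exploration vertex by vertex -/

/-- The weight of the structures consisting of `m + e * d` trees for some `e`, with weight `α e`
and with `e` counted in the size. -/
noncomputable def mixedWeight (a α : ℕ → ℝ) (d m n : ℕ) : ℝ :=
  ∑ p ∈ antidiagonal n, α p.1 * forestWeight a d (m + p.1 * d) p.2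

/-- The weights of the positions of the exploration of such a structure after `t` vertices, by
number of bouquets seen, on the event that it is not finished. -/
noncomputable def killedWalk (a α : ℕ → ℝ) (d m : ℕ) : ℕ → ℕ → ℝ
  | 0, e => if 0 < m + e * d then α e else 0
  | t + 1, e => if t + 1 < m + e * d then conv a (killedWalk a α d m t) e else 0

variable {α : ℕ → ℝ} {m : ℕ}

theorem killedWalk_nonneg (ha : ∀ k, 0 ≤ a k) (hα : ∀ k, 0 ≤ α k) (t e : ℕ) :
    0 ≤ killedWalk a α d m t e := by
  induction t generalizing e with
  | zero => rw [killedWalk]; split_ifs <;> simp [hα]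
  | succ t ih => rw [killedWalk]; split_ifs; exacts [conv_nonneg ha ih _, le_rfl]

theorem killedWalk_eq_zero {t e : ℕ} (h : m + e * d ≤ t) : killedWalk a α d m t e = 0 := by
  cases t with
  | zero => rw [killedWalk, if_neg (by omega)]
  | succ t => rw [killedWalk, if_neg (by omega)]

/-- Killing is invisible here: in a killed state no tree is left although bouquets remain, so the
future has weight zero. -/
theorem sum_trunc_mul_forestWeight (B : ℕ → ℝ) {t n : ℕ} (h : t < m + n * d) :
    ∑ p ∈ antidiagonal n,
        (if t < m + p.1 * d then B p.1 else 0) * forestWeight a d (m + p.1 * d - t) p.2 =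
      ∑ p ∈ antidiagonal n, B p.1 * forestWeight a d (m + p.1 * d - t) p.2 := by
  refine Finset.sum_congr rfl fun p hp => ?_
  have hp := mem_antidiagonal.1 hp
  split_ifs with h1
  · rfl
  · have : p.2 ≠ 0 := by
      intro h2
      rw [h2, add_zero] at hp
      exact h1 (hp ▸ h)
    rw [show m + p.1 * d - t = 0 by omega, forestWeight_zero, if_neg this]
    simp

/-- Decomposition at time `t` into past and future. A structure with `n` bouquets has `m + n * d`
vertices, so its exploration is alive at time `t` exactly when `t < m + n * d`. -/
theorem sum_killedWalk_mul_forestWeight (t n : ℕ) :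
    ∑ p ∈ antidiagonal n, killedWalk a α d m t p.1 * forestWeight a d (m + p.1 * d - t) p.2 =
      if t < m + n * d then mixedWeight a α d m n else 0 := by
  split_ifs with h
  · induction t with
    | zero =>
      simp only [killedWalk]
      rw [sum_trunc_mul_forestWeight α h]
      rfl
    | succ t ih =>
      simp only [killedWalk]
      rw [sum_trunc_mul_forestWeight _ h, ← ih (by omega), conv_comm]
      simp only [conv, Finset.sum_mul]
      have e1 : ∀ p : ℕ × ℕ, ∑ q ∈ antidiagonal p.1, killedWalk a α d m t q.1 * a q.2 *
          forestWeight a d (m + p.1 * d - (t + 1)) p.2 =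
          ∑ q ∈ antidiagonal p.1, killedWalk a α d m t q.1 * a q.2 *
          forestWeight a d (m + (q.1 + q.2) * d - (t + 1)) p.2 := fun p =>
        Finset.sum_congr rfl fun q hq => by rw [mem_antidiagonal.1 hq]
      simp only [e1]
      rw [← sum_antidiagonal_assoc n fun e k r =>
        killedWalk a α d m t e * a k * forestWeight a d (m + (e + k) * d - (t + 1)) r]
      refine Finset.sum_congr rfl fun p hp => ?_
      by_cases hl : m + p.1 * d ≤ t
      · simp [killedWalk_eq_zero hl]
      · rw [show m + p.1 * d - t = (m + p.1 * d - (t + 1)) + 1 by omega, forestWeight_succ,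
          Finset.mul_sum]
        refine Finset.sum_congr rfl fun q hq => ?_
        rw [add_mul, show m + (p.1 * d + q.1 * d) - (t + 1) = m + p.1 * d - (t + 1) + q.1 * d by
          omega, mul_assoc]
  · refine Finset.sum_eq_zero fun p hp => ?_
    have hp := mem_antidiagonal.1 hp
    have : p.1 * d ≤ n * d := Nat.mul_le_mul_right d (by omega)
    rw [killedWalk_eq_zero (by omega), zero_mul]

/-- The number `m + n * d - t` of vertices still to come does not depend on `e`; this turns the
future into a kernel in `n - e`. -/
theorem sum_mul_forestWeight_eq_sum_range {A : ℕ → ℝ} {t n : ℕ}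
    (hA : ∀ e, m + e * d ≤ t → A e = 0) (ht : t ≤ m + n * d) :
    ∑ p ∈ antidiagonal n, A p.1 * forestWeight a d (m + p.1 * d - t) p.2 =
      ∑ e ∈ Finset.range (n + 1), vertexWeight a d (m + n * d - t) (n - e) * A e := by
  rw [Finset.Nat.sum_antidiagonal_eq_sum_range_succ
    (fun i j => A i * forestWeight a d (m + i * d - t) j)]
  refine Finset.sum_congr rfl fun e he => ?_
  have he := Nat.lt_succ_iff.1 (Finset.mem_range.1 he)
  by_cases hl : m + e * d ≤ t
  · simp [hA e hl]
  · have : (n - e) * d + e * d = n * d := by rw [← add_mul]; congr 1; omega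
    rw [vertexWeight, if_pos (by omega),
      show m + n * d - t - (n - e) * d = m + e * d - t by omega, mul_comm]

/-- The composition formula for the pasts `A`, `B` and the futures for `n` and `n + 1`. It says that
the ratio of the `A`-sum to the `B`-sum increases with `n`. -/
theorem LROrder.sum_mul_forestWeight_le (hd : 1 ≤ d) (ha : RatioDecreasing a)
    (ha0 : ∀ k, 0 ≤ a k) {A B : ℕ → ℝ} (hAB : LROrder A B) {t n : ℕ}
    (hA : ∀ e, m + e * d ≤ t → A e = 0) (hB : ∀ e, m + e * d ≤ t → B e = 0)
    (ht : t ≤ m + n * d) :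
    (∑ p ∈ antidiagonal n, A p.1 * forestWeight a d (m + p.1 * d - t) p.2) *
        (∑ p ∈ antidiagonal (n + 1), B p.1 * forestWeight a d (m + p.1 * d - t) p.2) ≤
      (∑ p ∈ antidiagonal (n + 1), A p.1 * forestWeight a d (m + p.1 * d - t) p.2) *
        (∑ p ∈ antidiagonal n, B p.1 * forestWeight a d (m + p.1 * d - t) p.2) := by
  have hT : m + (n + 1) * d - t = m + n * d - t + d := by rw [add_mul, one_mul]; omega
  have ht' : t ≤ m + (n + 1) * d := by rw [add_mul, one_mul]; omega
  have ext : ∀ A : ℕ → ℝ,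
      ∑ e ∈ Finset.range (n + 1), vertexWeight a d (m + n * d - t) (n - e) * A e =
      ∑ e ∈ Finset.range (n + 1 + 1),
        shiftRight (vertexWeight a d (m + n * d - t)) (n + 1 - e) * A e := by
    intro A
    rw [Finset.sum_range_succ _ (n + 1), Nat.sub_self]
    simp only [shiftRight, zero_mul, add_zero]
    refine Finset.sum_congr rfl fun e he => ?_
    have he := Nat.lt_succ_iff.1 (Finset.mem_range.1 he)
    rw [show n + 1 - e = (n - e) + 1 by omega]
  rw [sum_mul_forestWeight_eq_sum_range hA ht, sum_mul_forestWeight_eq_sum_range hB ht,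
    sum_mul_forestWeight_eq_sum_range hA ht', sum_mul_forestWeight_eq_sum_range hB ht', hT, ext,
    ext]
  refine sum_mul_sum_le_of_lrOrder (n + 1 + 1) (fun p q hpq hq => ?_) hAB
  exact lrOrder_vertexWeight hd ha ha0 (m + n * d - t) (n + 1 - q) (n + 1 - p) (by omega)

/-- With one tree fewer, survival forces more bouquets to have been seen: at each step the two walks
are truncated to nested up-sets. -/
theorem lrOrder_killedWalk_succ (ha : RatioDecreasing a) (ha0 : ∀ k, 0 ≤ a k)
    (hα0 : ∀ k, 0 ≤ α k) (l t : ℕ) :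
    LROrder (killedWalk a α d l t) (killedWalk a α d (l + 1) t) := by
  have up : ∀ t i j, i ≤ j → t < l + i * d → t < l + j * d := fun t i j hij h =>
    h.trans_le (Nat.add_le_add_left (Nat.mul_le_mul_right d hij) l)
  induction t with
  | zero => exact (LROrder.refl α).trunc hα0 hα0 (up 0) fun i hi => by omega
  | succ t ih =>
    exact (ih.conv ha ha0).trunc (conv_nonneg ha0 (killedWalk_nonneg ha0 hα0 t))
      (conv_nonneg ha0 (killedWalk_nonneg ha0 hα0 t)) (up (t + 1)) fun i hi => by omega

/-- The sequence with a single `1` at index `e`. -/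
def unitSeq (e : ℕ) : ℕ → ℝ := fun n => if n = e then 1 else 0

theorem unitSeq_nonneg (e n : ℕ) : 0 ≤ unitSeq e n := by
  unfold unitSeq; split_ifs <;> simp

theorem conv_unitSeq_zero (α : ℕ → ℝ) : conv α (unitSeq 0) = α := by
  funext n
  rw [conv, Finset.sum_eq_single (n, 0)]
  · simp [unitSeq]
  · rintro ⟨i, j⟩ hp hne
    have : j ≠ 0 := by rintro rfl; simp_all
    simp [unitSeq, this]
  · simp

theorem conv_eq_zero_of_forall_le {A : ℕ → ℝ} {n : ℕ} (h : ∀ e ≤ n, A e = 0) :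
    conv α A n = 0 :=
  Finset.sum_eq_zero fun p hp => by
    rw [h p.2 (by have := mem_antidiagonal.1 hp; omega), mul_zero]

/-- A single tree that ends after exactly `t + 1` vertices has `t / d` bouquets, so the mass killed
in one step sits at a single point; there is none unless `d` divides `t`. -/
theorem conv_killedWalk_unitSeq (hd : 1 ≤ d) (ha0 : ∀ k, 0 ≤ a k) (t : ℕ) : ∃ c, 0 ≤ c ∧
    conv a (killedWalk a (unitSeq 0) d 1 t) =
      killedWalk a (unitSeq 0) d 1 (t + 1) + fun n => c * unitSeq (t / d) n := by
  refine ⟨if t / d * d = t then conv a (killedWalk a (unitSeq 0) d 1 t) (t / d) else 0, ?_, ?_⟩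
  · split_ifs
    exacts [conv_nonneg ha0 (killedWalk_nonneg ha0 (unitSeq_nonneg 0) t) _, le_rfl]
  · funext e
    simp only [Pi.add_apply, killedWalk]
    rcases lt_trichotomy (e * d) t with h | h | h
    · have hz : conv a (killedWalk a (unitSeq 0) d 1 t) e = 0 :=
        conv_eq_zero_of_forall_le fun e' he' => killedWalk_eq_zero (by
          have := Nat.mul_le_mul_right d he'
          omega)
      rw [if_neg (by omega), hz]
      split_ifs with h1
      · have : e ≠ t / d := by rintro rfl; omega
        simp [unitSeq, this]
      · simp
    · have h1 : t / d = e := by rw [← h, Nat.mul_div_cancel _ (by omega)]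
      rw [if_neg (by omega), h1, if_pos h]
      simp [unitSeq]
    · have h1 : e ≠ t / d := by
        rintro rfl
        have := Nat.div_mul_le_self t d
        omega
      rw [if_pos (by omega)]
      simp [unitSeq, h1]

/-- On the left the walk explores one tree and is killed at its end, while the choice weighted by
`α` is made independently; on the right that choice is made at the start and the whole structure is
explored. One step applies `conv a` to both sides, and the mass killed on the left lies below the
rest, so removing it preserves the order. -/
theorem lrOrder_conv_killedWalk (hd : 1 ≤ d) (ha : RatioDecreasing a) (ha0 : ∀ k, 0 ≤ a k)
    (hα : RatioDecreasing α) (hα0 : ∀ k, 0 ≤ α k) (l t : ℕ) :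
    LROrder (conv α (killedWalk a (unitSeq 0) d 1 t)) (killedWalk a α d (l + 1) t) := by
  induction t with
  | zero =>
    have e1 : killedWalk a (unitSeq 0) d 1 0 = unitSeq 0 :=
      funext fun e => by rw [killedWalk, if_pos (by omega)]
    have e2 : killedWalk a α d (l + 1) 0 = α :=
      funext fun e => by rw [killedWalk, if_pos (by omega)]
    rw [e1, e2, conv_unitSeq_zero]
    exact LROrder.refl α
  | succ t ih =>
    obtain ⟨c, hc, hdec⟩ := conv_killedWalk_unitSeq (a := a) hd ha0 t
    have hK0 := killedWalk_nonneg (d := d) (m := 1) ha0 (unitSeq_nonneg 0)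
    have hH0 := killedWalk_nonneg (d := d) (m := l + 1) ha0 hα0
    have hcu : ∀ n, 0 ≤ c * unitSeq (t / d) n := fun n => mul_nonneg hc (unitSeq_nonneg _ _)
    have hX : conv a (conv α (killedWalk a (unitSeq 0) d 1 t)) =
        conv α (killedWalk a (unitSeq 0) d 1 (t + 1)) +
          conv α fun n => c * unitSeq (t / d) n := by
      rw [← conv_assoc, conv_comm a α, conv_assoc, hdec, conv_add]
    -- The surviving walk vanishes up to the index `t / d` that carries the killed mass.
    have h1 : LROrder (killedWalk a (unitSeq 0) d 1 (t + 1)) fun n => c * unitSeq (t / d) n := by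
      intro i j hij
      by_cases hj : j = t / d
      · have hi : i * d ≤ t :=
          (Nat.mul_le_mul_right d (hij.le.trans hj.le)).trans (Nat.div_mul_le_self t d)
        rw [killedWalk_eq_zero (by omega), zero_mul]
        exact mul_nonneg (hK0 _ _) (hcu _)
      · have : c * unitSeq (t / d) j = 0 := by simp [unitSeq, hj]
        dsimp only
        rw [this, mul_zero]
        exact mul_nonneg (hK0 _ _) (hcu _)
    have h2 := h1.conv hα hα0
    have h3 : LROrder (conv a (conv α (killedWalk a (unitSeq 0) d 1 t)))
        (conv α fun n => c * unitSeq (t / d) n) := by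
      rw [hX]
      intro i j hij
      have := h2 i j hij
      simp only [Pi.add_apply]
      linarith [this]
    have h4 := h3.sub (ih.conv ha ha0) (conv_nonneg hα0 hcu)
      (fun n => by
        rw [hX, Pi.add_apply]
        linarith [conv_nonneg hα0 (hK0 (t + 1)) n])
      (conv_nonneg ha0 (hH0 t))
    have e1 : (fun n => conv a (conv α (killedWalk a (unitSeq 0) d 1 t)) n -
        conv α (fun n => c * unitSeq (t / d) n) n) =
        conv α (killedWalk a (unitSeq 0) d 1 (t + 1)) := by
      funext n
      rw [hX, Pi.add_apply, add_sub_cancel_right]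
    rw [e1] at h4
    intro i j hij
    -- It remains to truncate the right-hand walk. At the indices where it is killed, the left-hand
    -- sequence already vanishes.
    by_cases hi : t + 1 < l + 1 + i * d
    · have := Nat.mul_le_mul_right d hij.le
      rw [killedWalk, killedWalk, if_pos hi, if_pos (by omega)]
      exact h4 i j hij
    · have hz : conv α (killedWalk a (unitSeq 0) d 1 (t + 1)) i = 0 :=
        conv_eq_zero_of_forall_le fun e he => killedWalk_eq_zero (by
          have := Nat.mul_le_mul_right d he
          omega)
      rw [hz, zero_mul]
      exact mul_nonneg (conv_nonneg hα0 (hK0 _) _) (hH0 _ _)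

theorem mixedWeight_unitSeq (n : ℕ) : mixedWeight a (unitSeq 0) d m n = forestWeight a d m n := by
  rw [mixedWeight, Finset.sum_eq_single (0, n)]
  · simp [unitSeq]
  · rintro ⟨i, j⟩ hp hne
    have : i ≠ 0 := by rintro rfl; simp_all
    simp [unitSeq, this]
  · simp

theorem mixedWeight_nonneg (ha0 : ∀ k, 0 ≤ a k) (hα0 : ∀ k, 0 ≤ α k) (n : ℕ) :
    0 ≤ mixedWeight a α d m n :=
  Finset.sum_nonneg fun _ _ => mul_nonneg (hα0 _) (forestWeight_nonneg ha0 _ _)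

theorem mixedWeight_add (l : ℕ) (n : ℕ) : mixedWeight a α d (l + m) n =
    ∑ p ∈ antidiagonal n, mixedWeight a α d l p.1 * forestWeight a d m p.2 := by
  simp only [mixedWeight, Finset.sum_mul]
  rw [← sum_antidiagonal_assoc n fun e i j =>
    α e * forestWeight a d (l + e * d) i * forestWeight a d m j]
  refine Finset.sum_congr rfl fun p _ => ?_
  rw [show l + m + p.1 * d = l + p.1 * d + m by ring, forestWeight_add, Finset.mul_sum]
  simp only [mul_assoc]

/-! ### Monotone tails of the two components of a split -/

/-- The first component is explored first; it has more than `j` bouquets exactly when it is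
unfinished after `l + j * d` vertices. The additional tree then joins the future. -/
theorem sum_tail_mixedWeight (hd : 1 ≤ d) (l j n : ℕ) :
    ∑ p ∈ antidiagonal n, (if j < p.1 then mixedWeight a α d l p.1 * forestWeight a d 1 p.2
        else 0) =
      ∑ p ∈ antidiagonal n, killedWalk a α d l (l + j * d) p.1 *
        forestWeight a d (l + 1 + p.1 * d - (l + j * d)) p.2 := by
  have e1 : ∀ p : ℕ × ℕ, (if j < p.1 then mixedWeight a α d l p.1 * forestWeight a d 1 p.2
      else 0) = ∑ q ∈ antidiagonal p.1, killedWalk a α d l (l + j * d) q.1 *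
        forestWeight a d (l + q.1 * d - (l + j * d)) q.2 * forestWeight a d 1 p.2 := by
    intro p
    rw [← Finset.sum_mul, sum_killedWalk_mul_forestWeight, ite_mul, zero_mul]
    simp only [add_lt_add_iff_left, Nat.mul_lt_mul_right (show 0 < d by omega)]
  simp only [e1]
  rw [← sum_antidiagonal_assoc n fun e i k => killedWalk a α d l (l + j * d) e *
    forestWeight a d (l + e * d - (l + j * d)) i * forestWeight a d 1 k]
  refine Finset.sum_congr rfl fun p _ => ?_
  by_cases hl : l + p.1 * d ≤ l + j * d
  · simp [killedWalk_eq_zero hl]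
  · rw [show l + 1 + p.1 * d - (l + j * d) = l + p.1 * d - (l + j * d) + 1 by omega,
      forestWeight_add, Finset.mul_sum]
    simp only [mul_assoc]

/-- Now the single tree is explored first, and is unfinished after `1 + j * d` vertices. The
`α`-choice of the other component is counted with the past, so that the future is an ordinary
forest; this produces `conv α`. -/
theorem sum_tail_forestWeight (hd : 1 ≤ d) (l j n : ℕ) :
    ∑ p ∈ antidiagonal n, (if j < p.1 then forestWeight a d 1 p.1 * mixedWeight a α d l p.2
        else 0) =
      ∑ p ∈ antidiagonal n, conv α (killedWalk a (unitSeq 0) d 1 (1 + j * d)) p.1 *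
        forestWeight a d (l + 1 + p.1 * d - (1 + j * d)) p.2 := by
  have e1 : ∀ p : ℕ × ℕ, (if j < p.1 then forestWeight a d 1 p.1 * mixedWeight a α d l p.2
      else 0) = ∑ q ∈ antidiagonal p.1, ∑ r ∈ antidiagonal p.2,
        killedWalk a (unitSeq 0) d 1 (1 + j * d) q.1 *
        forestWeight a d (1 + q.1 * d - (1 + j * d)) q.2 *
          (α r.1 * forestWeight a d (l + r.1 * d) r.2) := by
    intro p
    simp only [← Finset.mul_sum]
    rw [← Finset.sum_mul, sum_killedWalk_mul_forestWeight, mixedWeight_unitSeq, ite_mul, zero_mul]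
    simp only [add_lt_add_iff_left, Nat.mul_lt_mul_right (show 0 < d by omega), mixedWeight]
  simp only [e1]
  rw [sum_antidiagonal_interchange n fun e i f k => killedWalk a (unitSeq 0) d 1 (1 + j * d) e *
    forestWeight a d (1 + e * d - (1 + j * d)) i * (α f * forestWeight a d (l + f * d) k)]
  refine Finset.sum_congr rfl fun p _ => ?_
  rw [conv_comm, conv, Finset.sum_mul]
  refine Finset.sum_congr rfl fun q hq => ?_
  have hq := mem_antidiagonal.1 hq
  by_cases hl : 1 + q.1 * d ≤ 1 + j * d
  · simp [killedWalk_eq_zero hl]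
  · have : l + 1 + p.1 * d - (1 + j * d) = (1 + q.1 * d - (1 + j * d)) + (l + q.2 * d) := by
      rw [← hq, add_mul]
      omega
    rw [this, forestWeight_add, Finset.mul_sum]
    exact Finset.sum_congr rfl fun r _ => by ring

theorem sum_killedWalk_eq_mixedWeight {l t n : ℕ} (h : t < l + 1 + n * d) :
    mixedWeight a α d (l + 1) n = ∑ p ∈ antidiagonal n,
      killedWalk a α d (l + 1) t p.1 * forestWeight a d (l + 1 + p.1 * d - t) p.2 := by
  rw [sum_killedWalk_mul_forestWeight, if_pos h]

theorem tail_mixedWeight_mono (hd : 1 ≤ d) (ha : RatioDecreasing a) (ha0 : ∀ k, 0 ≤ a k)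
    (hα0 : ∀ k, 0 ≤ α k) (l j n : ℕ) :
    (∑ p ∈ antidiagonal n, (if j < p.1 then mixedWeight a α d l p.1 * forestWeight a d 1 p.2
        else 0)) * mixedWeight a α d (l + 1) (n + 1) ≤
    (∑ p ∈ antidiagonal (n + 1), (if j < p.1 then
      mixedWeight a α d l p.1 * forestWeight a d 1 p.2 else 0)) *
      mixedWeight a α d (l + 1) n := by
  by_cases hj : j ≤ n
  · have h1 := Nat.mul_le_mul_right d hj
    have h2 := Nat.mul_le_mul_right d (Nat.le_succ n)
    simp only [Nat.succ_eq_add_one] at h2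
    rw [sum_tail_mixedWeight hd, sum_tail_mixedWeight hd,
      sum_killedWalk_eq_mixedWeight (t := l + j * d) (n := n) (by omega),
      sum_killedWalk_eq_mixedWeight (t := l + j * d) (n := n + 1) (by omega)]
    exact (lrOrder_killedWalk_succ ha ha0 hα0 l _).sum_mul_forestWeight_le hd ha ha0
      (fun e he => killedWalk_eq_zero (by omega)) (fun e he => killedWalk_eq_zero he) (by omega)
  · rw [Finset.sum_eq_zero fun p hp => if_neg (by have := mem_antidiagonal.1 hp; omega), zero_mul]
    refine mul_nonneg (Finset.sum_nonneg fun p _ => ?_) (mixedWeight_nonneg ha0 hα0 _)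
    split_ifs
    exacts [mul_nonneg (mixedWeight_nonneg ha0 hα0 _) (forestWeight_nonneg ha0 _ _), le_rfl]

theorem tail_forestWeight_mono (hd : 1 ≤ d) (ha : RatioDecreasing a) (ha0 : ∀ k, 0 ≤ a k)
    (hα : RatioDecreasing α) (hα0 : ∀ k, 0 ≤ α k) (l j n : ℕ) :
    (∑ p ∈ antidiagonal n, (if j < p.1 then forestWeight a d 1 p.1 * mixedWeight a α d l p.2
        else 0)) * mixedWeight a α d (l + 1) (n + 1) ≤
    (∑ p ∈ antidiagonal (n + 1), (if j < p.1 then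
      forestWeight a d 1 p.1 * mixedWeight a α d l p.2 else 0)) *
      mixedWeight a α d (l + 1) n := by
  by_cases hj : j < n
  · have h1 := Nat.mul_le_mul_right d hj
    have h2 := Nat.mul_le_mul_right d (Nat.le_succ n)
    simp only [Nat.succ_eq_add_one, add_mul, one_mul] at h1 h2
    rw [sum_tail_forestWeight hd, sum_tail_forestWeight hd,
      sum_killedWalk_eq_mixedWeight (t := 1 + j * d) (n := n) (by omega),
      sum_killedWalk_eq_mixedWeight (t := 1 + j * d) (n := n + 1) (by rw [add_mul]; omega)]
    exact (lrOrder_conv_killedWalk hd ha ha0 hα hα0 l _).sum_mul_forestWeight_le hd ha ha0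
      (fun e he => conv_eq_zero_of_forall_le fun e' he' => killedWalk_eq_zero (by
        have := Nat.mul_le_mul_right d he'
        omega))
      (fun e he => killedWalk_eq_zero he) (by omega)
  · rw [Finset.sum_eq_zero fun p hp => if_neg (by have := mem_antidiagonal.1 hp; omega), zero_mul]
    refine mul_nonneg (Finset.sum_nonneg fun p _ => ?_) (mixedWeight_nonneg ha0 hα0 _)
    split_ifs
    exacts [mul_nonneg (forestWeight_nonneg ha0 _ _) (mixedWeight_nonneg ha0 hα0 _), le_rfl]

theorem forestWeight_pos (hd : 1 ≤ d) (ha0 : ∀ k, 0 ≤ a k) (h0 : 0 < a 0) (h1 : 0 < a 1)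
    {y : ℕ} (hy : 0 < y) (n : ℕ) : 0 < forestWeight a d y n := by
  have hz : ∀ y, 0 < forestWeight a d y 0 := by
    intro y
    induction y with
    | zero => simp [forestWeight_zero]
    | succ y ih => simpa [forestWeight_succ] using mul_pos h0 ih
  induction n generalizing y with
  | zero => exact hz y
  | succ n ih =>
    obtain ⟨y, rfl⟩ : ∃ z, y = z + 1 := ⟨y - 1, by omega⟩
    rw [forestWeight_succ]
    refine (mul_pos h1 (ih (y := y + 1 * d) (by omega))).trans_le ?_
    exact Finset.single_le_sum
      (f := fun p : ℕ × ℕ => a p.1 * forestWeight a d (y + p.1 * d) p.2)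
      (fun p _ => mul_nonneg (ha0 _) (forestWeight_nonneg ha0 _ _))
      (show (1, n) ∈ antidiagonal (n + 1) by simp [add_comm])

/-- With no forced tree but a bouquet left, at least one batch of `d` trees must come; that batch
becomes forced. -/
theorem mixedWeight_zero_succ (n : ℕ) : mixedWeight a α d 0 (n + 1) =
    mixedWeight a (fun e => α (e + 1)) d d n := by
  rw [mixedWeight, Finset.Nat.sum_antidiagonal_succ]
  simp only [mixedWeight, zero_mul, add_zero, forestWeight_zero, Nat.succ_ne_zero, if_false,
    mul_zero, zero_add, add_mul, one_mul, add_comm d]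

end ForestWeight

/-! ### Couplings of discrete laws and of splits -/

/-- Two laws can be coupled so that a relation holds almost surely. -/
def RelCoupled {α : Type*} (R : α → α → Prop) (p q : PMF α) : Prop :=
  ∃ κ : PMF (α × α), κ.map Prod.fst = p ∧ κ.map Prod.snd = q ∧ ∀ x ∈ κ.support, R x.1 x.2

theorem PMF.bind_congr_support {α β : Type*} (p : PMF α) {f g : α → PMF β}
    (h : ∀ x ∈ p.support, f x = g x) : p.bind f = p.bind g := by
  ext b
  rw [PMF.bind_apply, PMF.bind_apply]
  refine tsum_congr fun x => ?_
  by_cases hx : x ∈ p.support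
  · rw [h x hx]
  · rw [(PMF.apply_eq_zero_iff p x).2 hx, zero_mul, zero_mul]

/-- Two laws on `ℕ` with interlaced distribution functions can be coupled so that the difference is
`0` or `1`. -/
theorem PMF.exists_increment_coupling (P P' : PMF ℕ)
    (hA : ∀ j, ∑ i ∈ Finset.range j, P' i ≤ ∑ i ∈ Finset.range j, P i)
    (hB : ∀ j, ∑ i ∈ Finset.range j, P i ≤ ∑ i ∈ Finset.range (j + 1), P' i) :
    ∃ κ : PMF (ℕ × Bool), κ.map Prod.fst = P ∧
      κ.map (fun x => if x.2 then x.1 + 1 else x.1) = P' := by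
  set S : ℕ → ℝ≥0∞ := fun j => ∑ i ∈ Finset.range j, P i with hS
  set S' : ℕ → ℝ≥0∞ := fun j => ∑ i ∈ Finset.range j, P' i with hS'
  have hStop : ∀ j, S j ≠ ∞ := fun j => ENNReal.sum_ne_top.2 fun i _ => P.apply_ne_top i
  have hStop' : ∀ j, S' j ≠ ∞ := fun j => ENNReal.sum_ne_top.2 fun i _ => P'.apply_ne_top i
  have hSs : ∀ j, S (j + 1) - S j = P j := fun j => by
    simp only [hS, Finset.sum_range_succ]
    exact ENNReal.add_sub_cancel_left (hStop j)
  have hSs' : ∀ j, S' (j + 1) - S' j = P' j := fun j => by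
    simp only [hS', Finset.sum_range_succ]
    exact ENNReal.add_sub_cancel_left (hStop' j)
  -- Quantile coupling: the interval from `S i` to `S (i + 1)` is cut at `S' (i + 1)`, the part
  -- below being sent to `i` and the part above to `i + 1`.
  set f : ℕ × Bool → ℝ≥0∞ := fun x =>
    if x.2 then S (x.1 + 1) - S' (x.1 + 1) else S' (x.1 + 1) - S x.1 with hf
  have hrow : ∀ i, f (i, true) + f (i, false) = P i := fun i => by
    simp only [hf, if_true, Bool.false_eq_true, if_false]
    rw [tsub_add_tsub_cancel (hA _) (hB _), hSs]
  have hsum : ∑' x, f x = 1 := by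
    rw [ENNReal.tsum_prod', ← P.tsum_coe]
    refine tsum_congr fun i => ?_
    rw [tsum_bool, add_comm, hrow]
  obtain ⟨κ, hκ⟩ : ∃ κ : PMF (ℕ × Bool), ∀ x, κ x = f x :=
    ⟨⟨f, hsum ▸ ENNReal.summable.hasSum⟩, fun _ => rfl⟩
  refine ⟨κ, ?_, ?_⟩
  · ext i
    rw [PMF.map_apply, ENNReal.tsum_prod', tsum_eq_single i]
    · simp only [tsum_bool, if_true, hκ]
      rw [add_comm, hrow]
    · intro j hj
      simp [hj.symm]
  · ext i
    rw [PMF.map_apply, ENNReal.tsum_prod']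
    simp only [tsum_bool, hκ, Bool.false_eq_true, if_false, if_true]
    rw [ENNReal.tsum_add]
    have h1 : ∑' j, (if i = j then f (j, false) else 0) = S' (i + 1) - S i := by
      rw [tsum_eq_single i]
      · simp [hf]
      · intro j hj
        simp [hj.symm]
    rw [h1]
    cases i with
    | zero =>
      rw [ENNReal.tsum_eq_zero.2 (fun j => by simp), add_zero, ← hSs' 0]
      simp [hS, hS']
    | succ i =>
      rw [tsum_eq_single i]
      · simp only [if_true, hf]
        rw [tsub_add_tsub_cancel (hB _) (hA _), hSs']
      · intro j hj
        have : i ≠ j := hj.symm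
        simp [this]

section Split

open Finset.HasAntidiagonal

/-- The law of the first component of a pair of sizes with sum `n` and weight `u i * v (n - i)`. -/
noncomputable def splitPMF (u v : ℕ → ℝ) (n : ℕ) : PMF ℕ :=
  if h : 0 < ∑ p ∈ antidiagonal n, u p.1 * v p.2 ∧ ∀ i ≤ n, 0 ≤ u i * v (n - i) then
    PMF.ofFinset
      (fun i => if i ≤ n then
        ENNReal.ofReal (u i * v (n - i) / ∑ p ∈ antidiagonal n, u p.1 * v p.2) else 0)
      (Finset.range (n + 1))
      (by
        rw [Finset.sum_congr rfl fun i hi => if_pos (Nat.lt_succ_iff.1 (Finset.mem_range.1 hi)),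
          ← ENNReal.ofReal_sum_of_nonneg fun i hi => div_nonneg
            (h.2 i (Nat.lt_succ_iff.1 (Finset.mem_range.1 hi))) h.1.le, ← Finset.sum_div,
          Finset.Nat.sum_antidiagonal_eq_sum_range_succ (fun i j => u i * v j),
          div_self, ENNReal.ofReal_one]
        rw [← Finset.Nat.sum_antidiagonal_eq_sum_range_succ (fun i j => u i * v j)]
        exact h.1.ne')
      (fun i hi => if_neg (by simpa [Nat.lt_succ_iff] using hi))
  else PMF.pure 0

variable {u v : ℕ → ℝ}

theorem le_of_mem_support_splitPMF {n i : ℕ} (h : i ∈ (splitPMF u v n).support) : i ≤ n := by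
  by_contra hi
  unfold splitPMF at h
  split_ifs at h with h0
  · simp [hi] at h
  · simp at h; omega

theorem splitPMF_apply (hu : ∀ i, 0 ≤ u i) (hv : ∀ i, 0 ≤ v i) {n : ℕ}
    (hc : 0 < ∑ p ∈ antidiagonal n, u p.1 * v p.2) (i : ℕ) :
    splitPMF u v n i = if i ≤ n then
      ENNReal.ofReal (u i * v (n - i) / ∑ p ∈ antidiagonal n, u p.1 * v p.2) else 0 := by
  rw [splitPMF, dif_pos ⟨hc, fun i _ => mul_nonneg (hu _) (hv _)⟩, PMF.ofFinset_apply]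

theorem splitPMF_mul (hu : ∀ i, 0 ≤ u i) (hv : ∀ i, 0 ≤ v i) (n i : ℕ) :
    splitPMF u v n i * ENNReal.ofReal (∑ p ∈ antidiagonal n, u p.1 * v p.2) =
      if i ≤ n then ENNReal.ofReal (u i * v (n - i)) else 0 := by
  have h0 : 0 ≤ ∑ p ∈ antidiagonal n, u p.1 * v p.2 :=
    Finset.sum_nonneg fun p _ => mul_nonneg (hu _) (hv _)
  rcases h0.eq_or_lt with hc | hc
  · rw [← hc]
    split_ifs with hi
    · have := (Finset.sum_eq_zero_iff_of_nonneg fun p _ => mul_nonneg (hu _) (hv _)).1 hc.symm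
        (i, n - i) (mem_antidiagonal.2 (by simp; omega))
      rw [this]
      simp
    · simp
  · rw [splitPMF_apply hu hv hc]
    split_ifs with hi
    · rw [← ENNReal.ofReal_mul (div_nonneg (mul_nonneg (hu _) (hv _)) hc.le),
        div_mul_cancel₀ _ hc.ne']
    · simp

theorem sum_range_splitPMF (hu : ∀ i, 0 ≤ u i) (hv : ∀ i, 0 ≤ v i) {n : ℕ}
    (hc : 0 < ∑ p ∈ antidiagonal n, u p.1 * v p.2) (j : ℕ) :
    ∑ i ∈ Finset.range j, splitPMF u v n i = ENNReal.ofReal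
      ((∑ p ∈ antidiagonal n, if p.1 < j then u p.1 * v p.2 else 0) /
        ∑ p ∈ antidiagonal n, u p.1 * v p.2) := by
  have e1 : ∀ i, splitPMF u v n i = ENNReal.ofReal (if i ≤ n then
      u i * v (n - i) / ∑ p ∈ antidiagonal n, u p.1 * v p.2 else 0) := fun i => by
    rw [splitPMF_apply hu hv hc]; split_ifs <;> simp
  rw [Finset.sum_congr rfl fun i _ => e1 i, ← ENNReal.ofReal_sum_of_nonneg]
  · congr 1
    generalize ∑ p ∈ antidiagonal n, u p.1 * v p.2 = c
    rw [Finset.sum_div, Finset.Nat.sum_antidiagonal_eq_sum_range_succ_mk, ← Finset.sum_filter,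
      Finset.sum_congr rfl (s₁ := Finset.range n.succ) (g := fun i => if i < j then
        u i * v (n - i) / c else 0) fun i _ => by dsimp only; split_ifs <;> simp,
      ← Finset.sum_filter]
    refine Finset.sum_congr ?_ fun _ _ => rfl
    ext i
    simp only [Finset.mem_filter, Finset.mem_range]
    omega
  · intro i _
    split_ifs
    exacts [div_nonneg (mul_nonneg (hu _) (hv _)) hc.le, le_rfl]

/-- If both components of the split of `n + 1` have larger tails than those of the split of `n`,
then the splits can be coupled by adding one to a single component. -/
theorem exists_split_coupling (hu : ∀ i, 0 ≤ u i) (hv : ∀ i, 0 ≤ v i) {n : ℕ}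
    (hc : 0 < ∑ p ∈ antidiagonal n, u p.1 * v p.2)
    (hc' : 0 < ∑ p ∈ antidiagonal (n + 1), u p.1 * v p.2)
    (h1 : ∀ j, (∑ p ∈ antidiagonal n, if j < p.1 then u p.1 * v p.2 else 0) *
        (∑ p ∈ antidiagonal (n + 1), u p.1 * v p.2) ≤
      (∑ p ∈ antidiagonal (n + 1), if j < p.1 then u p.1 * v p.2 else 0) *
        (∑ p ∈ antidiagonal n, u p.1 * v p.2))
    (h2 : ∀ j, (∑ p ∈ antidiagonal n, if j < p.2 then u p.1 * v p.2 else 0) *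
        (∑ p ∈ antidiagonal (n + 1), u p.1 * v p.2) ≤
      (∑ p ∈ antidiagonal (n + 1), if j < p.2 then u p.1 * v p.2 else 0) *
        (∑ p ∈ antidiagonal n, u p.1 * v p.2)) :
    ∃ κ : PMF (ℕ × Bool), κ.map Prod.fst = splitPMF u v n ∧
      κ.map (fun x => if x.2 then x.1 + 1 else x.1) = splitPMF u v (n + 1) := by
  refine PMF.exists_increment_coupling _ _ (fun j => ?_) (fun j => ?_)
  · rw [sum_range_splitPMF hu hv hc, sum_range_splitPMF hu hv hc']
    refine ENNReal.ofReal_le_ofReal ?_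
    rw [div_le_div_iff₀ hc' hc]
    cases j with
    | zero => simp
    | succ j =>
      have hcompl : ∀ N, (∑ p ∈ antidiagonal N, if p.1 < j + 1 then u p.1 * v p.2 else 0) =
          (∑ p ∈ antidiagonal N, u p.1 * v p.2) -
            ∑ p ∈ antidiagonal N, if j < p.1 then u p.1 * v p.2 else 0 := by
        intro N
        rw [← Finset.sum_sub_distrib]
        refine Finset.sum_congr rfl fun p _ => ?_
        by_cases h : j < p.1
        · rw [if_pos h, if_neg (by omega), sub_self]
        · rw [if_neg h, if_pos (by omega), sub_zero]
      rw [hcompl, hcompl]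
      linarith [h1 j]
  · rw [sum_range_splitPMF hu hv hc, sum_range_splitPMF hu hv hc']
    refine ENNReal.ofReal_le_ofReal ?_
    rw [div_le_div_iff₀ hc hc']
    -- For sums `n` and `n + 1`, the conditions `p.1 < j` and `p.1 < j + 1` become the same
    -- condition `n - j < p.2` on the second coordinate.
    by_cases hj : j ≤ n
    · have e1 : (∑ p ∈ antidiagonal n, if p.1 < j then u p.1 * v p.2 else 0) =
          ∑ p ∈ antidiagonal n, if n - j < p.2 then u p.1 * v p.2 else 0 := by
        refine Finset.sum_congr rfl fun p hp => ?_
        have hp := mem_antidiagonal.1 hp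
        congr 1
        simp only [eq_iff_iff]
        omega
      have e2 : (∑ p ∈ antidiagonal (n + 1), if p.1 < j + 1 then u p.1 * v p.2 else 0) =
          ∑ p ∈ antidiagonal (n + 1), if n - j < p.2 then u p.1 * v p.2 else 0 := by
        refine Finset.sum_congr rfl fun p hp => ?_
        have hp := mem_antidiagonal.1 hp
        congr 1
        simp only [eq_iff_iff]
        omega
      rw [e1, e2]
      exact h2 _
    · have e1 : ∀ {N k}, N < k → (∑ p ∈ antidiagonal N, if p.1 < k then u p.1 * v p.2 else 0) =
          ∑ p ∈ antidiagonal N, u p.1 * v p.2 := fun {N k} hN =>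
        Finset.sum_congr rfl fun p hp => if_pos (by have := mem_antidiagonal.1 hp; omega)
      rw [e1 (by omega), e1 (by omega), mul_comm]

end Split

/-! ### Recursive plane forests, their laws and the coupling -/

/-- Plane forests: a forest is empty, or its first tree has the forest `t` above its root and is
followed by the forest `r`. A plane tree is encoded by the forest above its root. -/
inductive PForest where
  | nil : PForest
  | cons (t r : PForest) : PForest

namespace PForest

/-- The number of vertices. -/
def count : PForest → ℕ
  | nil => 0
  | cons t r => count t + count r + 1

/-- The forest of `k` trees reduced to their root. -/
def leaves : ℕ → PForest
  | 0 => nil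
  | k + 1 => cons nil (leaves k)

/-- The weight of a tree whose root has `o` children already weighted and the forest of the other
children. -/
def rootWeight (w : ℕ → ℝ) : ℕ → PForest → ℝ
  | o, nil => w o
  | o, cons t r => rootWeight w 0 t * rootWeight w (o + 1) r

/-- Adding `d` leaves as the rightmost children of some vertex, or at the end of the forest. -/
inductive Grow (d : ℕ) : PForest → PForest → Prop
  | nil : Grow d nil (leaves d)
  | left {t t' : PForest} (r : PForest) (h : Grow d t t') : Grow d (cons t r) (cons t' r)
  | right (t : PForest) {r r' : PForest} (h : Grow d r r') : Grow d (cons t r) (cons t r')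

theorem rootWeight_nonneg {w : ℕ → ℝ} (hw : ∀ k, 0 ≤ w k) (c : PForest) (o : ℕ) :
    0 ≤ rootWeight w o c := by
  induction c generalizing o with
  | nil => exact hw o
  | cons t r iht ihr => exact mul_nonneg (iht 0) (ihr (o + 1))

theorem dvd_of_rootWeight_ne_zero {w : ℕ → ℝ} {d : ℕ} (hw : ∀ k, w k ≠ 0 → d ∣ k) (c : PForest)
    (o : ℕ) (h : rootWeight w o c ≠ 0) : d ∣ o + count c := by
  induction c generalizing o with
  | nil => exact hw o h
  | cons t r iht ihr =>
    have h := mul_ne_zero_iff.1 h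
    have := (Nat.dvd_add (iht 0 h.1) (ihr (o + 1) h.2))
    convert this using 1
    simp only [count]
    ring

section Law

open Finset.HasAntidiagonal

variable (w : ℕ → ℝ) (d : ℕ)

/-- The total weight, for `n` bouquets to be placed, of the forests of `l` trees followed by the
remaining children of a vertex with `o + l` children so far. -/
noncomputable def partitionFn (l o n : ℕ) : ℝ :=
  mixedWeight (fun k => w (k * d)) (fun e => w (o + l + e * d)) d l n

/-- The weight of the trees with `n` bouquets. -/
noncomputable def treeWeight (n : ℕ) : ℝ := forestWeight (fun k => w (k * d)) d 1 n

/-- The law of a random forest of `l` trees followed by the remaining children of a vertex with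
`o + l` children so far, with `n` bouquets to be placed. -/
noncomputable def law : ℕ → ℕ → ℕ → PMF PForest
  | 0, _, 0 => PMF.pure nil
  | 0, o, n + 1 => law d o n
  | l + 1, o, n => (splitPMF (treeWeight w d) (partitionFn w d l (o + 1)) n).bind fun i =>
      (law 0 0 (min i n)).bind fun t => (law l (o + 1) (n - i)).map (cons t)
termination_by l _ n => (n, l)
decreasing_by
  · simp [Prod.lex_def]
  · simp only [Prod.lex_def]; omega
  · simp only [Prod.lex_def]; omega

/-- Lexicographic induction on `(n, l)`: when no forced child is left, a bouquet is spent to create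
`d` of them. -/
theorem law_induction {P : ℕ → ℕ → ℕ → Prop} (zero : ∀ o, P 0 o 0)
    (bouquet : ∀ o n, P d o n → P 0 o (n + 1))
    (succ : ∀ l o n, (∀ i ≤ n, P 0 0 i) → (∀ k ≤ n, P l (o + 1) k) → P (l + 1) o n)
    (l o n : ℕ) : P l o n := by
  induction n using Nat.strong_induction_on generalizing l o with
  | _ n ih =>
    have h0 : ∀ o, P 0 o n := by
      intro o
      cases n with
      | zero => exact zero o
      | succ n => exact bouquet o n (ih n (Nat.lt_succ_self n) d o)
    induction l generalizing o with
    | zero => exact h0 o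
    | succ l ihl =>
      refine succ l o n (fun i hi => ?_) fun k hk => ?_
      · rcases hi.eq_or_lt with rfl | hi
        exacts [h0 0, ih i hi 0 0]
      · rcases hk.eq_or_lt with rfl | hk
        exacts [ihl (o + 1), ih k hk l (o + 1)]

theorem law_zero_zero (o : ℕ) : law w d 0 o 0 = PMF.pure nil := by rw [law]

theorem law_zero_succ (o n : ℕ) : law w d 0 o (n + 1) = law w d d o n := by rw [law]

theorem law_succ (l o n : ℕ) : law w d (l + 1) o n =
    (splitPMF (treeWeight w d) (partitionFn w d l (o + 1)) n).bind fun i =>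
      (law w d 0 0 i).bind fun t => (law w d l (o + 1) (n - i)).map (cons t) := by
  rw [law]
  refine PMF.bind_congr_support _ fun i hi => ?_
  rw [min_eq_left (le_of_mem_support_splitPMF hi)]

theorem law_size_zero (l o : ℕ) : law w d l o 0 = PMF.pure (leaves l) := by
  induction l generalizing o with
  | zero => exact law_zero_zero w d o
  | succ l ih =>
    rw [law_succ, PMF.bind_congr_support (g := fun _ => PMF.pure (leaves (l + 1)))]
    · exact PMF.bind_const _ _
    · intro i hi
      obtain rfl : i = 0 := Nat.le_zero.1 (le_of_mem_support_splitPMF hi)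
      rw [ih, law_zero_zero, PMF.pure_bind, PMF.pure_map]
      rfl

variable {w d}

theorem treeWeight_nonneg (hw : ∀ k, 0 ≤ w k) (n : ℕ) : 0 ≤ treeWeight w d n :=
  forestWeight_nonneg (fun _ => hw _) 1 n

theorem partitionFn_nonneg (hw : ∀ k, 0 ≤ w k) (l o n : ℕ) : 0 ≤ partitionFn w d l o n :=
  mixedWeight_nonneg (fun _ => hw _) (fun _ => hw _) n

theorem partitionFn_zero_zero (n : ℕ) : partitionFn w d 0 0 n = treeWeight w d n := by
  rw [treeWeight, partitionFn, show (1 : ℕ) = 0 + 1 from rfl, forestWeight_succ, mixedWeight]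
  simp

theorem partitionFn_zero_succ (o n : ℕ) : partitionFn w d 0 o (n + 1) = partitionFn w d d o n := by
  rw [partitionFn, mixedWeight_zero_succ, partitionFn]
  congr 1
  funext e
  congr 1
  ring

theorem partitionFn_succ (l o n : ℕ) : partitionFn w d (l + 1) o n =
    ∑ p ∈ antidiagonal n, treeWeight w d p.1 * partitionFn w d l (o + 1) p.2 := by
  rw [← Finset.Nat.sum_antidiagonal_swap]
  simp only [Prod.fst_swap, Prod.snd_swap, mul_comm (treeWeight w d _)]
  simp only [partitionFn, treeWeight, show o + 1 + l = o + (l + 1) by ring]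
  exact mixedWeight_add l n

/-- The recursive law is the normalized weight; the product form avoids dividing by a partition
function that may vanish. Divisibility of the degrees determines how many bouquets the first tree
has, so only one term of the sum over splits survives. -/
theorem law_apply_mul (hd : 1 ≤ d) (hw : ∀ k, 0 ≤ w k) (hsupp : ∀ k, w k ≠ 0 → d ∣ k)
    (l o n : ℕ) (hl : l ≤ d) (c : PForest) :
    law w d l o n c * ENNReal.ofReal (partitionFn w d l o n) =
      if count c = l + n * d then ENNReal.ofReal (rootWeight w o c) else 0 := by
  classical
  refine law_induction d (P := fun l o n => l ≤ d → ∀ c, law w d l o n c *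
    ENNReal.ofReal (partitionFn w d l o n) =
      if count c = l + n * d then ENNReal.ofReal (rootWeight w o c) else 0) ?_ ?_ ?_ l o n hl c
  · intro o _ c
    rw [law_zero_zero, PMF.pure_apply]
    cases c with
    | nil => simp [count, rootWeight, partitionFn, mixedWeight, forestWeight_zero]
    | cons t r => simp [count]
  · intro o n ih _ c
    rw [law_zero_succ, partitionFn_zero_succ, ih le_rfl, add_mul, one_mul, zero_add,
      add_comm (n * d)]
  · intro l o n ih0 ih hl c
    have hu := treeWeight_nonneg (d := d) hw
    have hv := partitionFn_nonneg (d := d) hw l (o + 1)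
    rw [law_succ, partitionFn_succ, PMF.bind_apply, ← ENNReal.tsum_mul_right]
    cases c with
    | nil =>
      rw [if_neg (by simp only [count]; omega)]
      refine ENNReal.tsum_eq_zero.2 fun i => ?_
      have : ((law w d 0 0 i).bind fun t => (law w d l (o + 1) (n - i)).map (cons t)) nil = 0 := by
        rw [PMF.apply_eq_zero_iff]
        simp
      rw [this, mul_zero, zero_mul]
    | cons t r =>
      have hbind : ∀ i, ((law w d 0 0 i).bind fun t =>
          (law w d l (o + 1) (n - i)).map (cons t)) (cons t r) =
          law w d 0 0 i t * law w d l (o + 1) (n - i) r := by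
        intro i
        rw [PMF.bind_apply, tsum_eq_single t]
        · rw [PMF.map_apply, tsum_eq_single r]
          · simp
          · intro r' hr'
            rw [if_neg]
            rintro ⟨⟩
            exact hr' rfl
        · intro t' ht'
          rw [PMF.map_apply, ENNReal.tsum_eq_zero.2, mul_zero]
          intro r'
          rw [if_neg]
          rintro ⟨⟩
          exact ht' rfl
      have hterm : ∀ i, splitPMF (treeWeight w d) (partitionFn w d l (o + 1)) n i *
          ((law w d 0 0 i).bind fun t =>
            (law w d l (o + 1) (n - i)).map (cons t)) (cons t r) *
          ENNReal.ofReal (∑ p ∈ antidiagonal n,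
            treeWeight w d p.1 * partitionFn w d l (o + 1) p.2) =
          if i ≤ n ∧ count t = i * d ∧ count r = l + (n - i) * d then
            ENNReal.ofReal (rootWeight w o (cons t r)) else 0 := by
        intro i
        rw [hbind, mul_right_comm, splitPMF_mul hu hv]
        by_cases hi : i ≤ n
        · have h1 := ih0 i hi (Nat.zero_le d) t
          have h2 := ih (n - i) (Nat.sub_le n i) (by omega) r
          rw [partitionFn_zero_zero, zero_add] at h1
          rw [if_pos hi, ENNReal.ofReal_mul (hu i), mul_mul_mul_comm,
            mul_comm (ENNReal.ofReal (treeWeight w d i)), h1,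
            mul_comm (ENNReal.ofReal (partitionFn w d l (o + 1) (n - i))), h2, rootWeight,
            ENNReal.ofReal_mul (rootWeight_nonneg hw t 0)]
          by_cases h3 : count t = i * d <;> by_cases h4 : count r = l + (n - i) * d <;>
            simp [hi, h3, h4]
        · simp [hi]
      simp only [hterm]
      by_cases hz : rootWeight w o (cons t r) = 0
      · simp [hz]
      · obtain ⟨i, hi⟩ : d ∣ count t := by
          simpa using dvd_of_rootWeight_ne_zero hsupp t 0 (left_ne_zero_of_mul hz)
        rw [tsum_eq_single i]
        · refine if_congr ?_ rfl rfl
          simp only [count]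
          rw [mul_comm] at hi
          constructor
          · rintro ⟨h1, h2, h3⟩
            have : i * d + (n - i) * d = n * d := by rw [← add_mul]; congr 1; omega
            omega
          · intro h
            -- Here `l < d` matters: a first tree with `n + 1` bouquets would already have too many
            -- vertices.
            have hin : i ≤ n := by
              by_contra hin
              have := Nat.mul_le_mul_right d (show n + 1 ≤ i by omega)
              rw [add_mul, one_mul] at this
              omega
            have : i * d + (n - i) * d = n * d := by rw [← add_mul]; congr 1; omega
            omega
        · intro j hj
          rw [if_neg]
          rintro ⟨_, h2, _⟩
          refine hj (Nat.eq_of_mul_eq_mul_right (show 0 < d by omega) ?_)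
          rw [← h2, hi, mul_comm]

/-- After coupling the splits, the component that gains a bouquet follows the inductive coupling,
and the other one is sampled once and shared by both forests. -/
theorem relCoupled_law_succ (hw : ∀ k, 0 ≤ w k) {l o n : ℕ}
    (hZ : partitionFn w d (l + 1) o n ≠ 0) (hZ' : partitionFn w d (l + 1) o (n + 1) ≠ 0)
    (h1 : ∀ j, (∑ p ∈ antidiagonal n, if j < p.1 then
          treeWeight w d p.1 * partitionFn w d l (o + 1) p.2 else 0) *
        partitionFn w d (l + 1) o (n + 1) ≤
      (∑ p ∈ antidiagonal (n + 1), if j < p.1 then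
          treeWeight w d p.1 * partitionFn w d l (o + 1) p.2 else 0) * partitionFn w d (l + 1) o n)
    (h2 : ∀ j, (∑ p ∈ antidiagonal n, if j < p.2 then
          treeWeight w d p.1 * partitionFn w d l (o + 1) p.2 else 0) *
        partitionFn w d (l + 1) o (n + 1) ≤
      (∑ p ∈ antidiagonal (n + 1), if j < p.2 then
          treeWeight w d p.1 * partitionFn w d l (o + 1) p.2 else 0) * partitionFn w d (l + 1) o n)
    (ht : ∀ i ≤ n, treeWeight w d i ≠ 0 → treeWeight w d (i + 1) ≠ 0 →
      RelCoupled (Grow d) (law w d 0 0 i) (law w d 0 0 (i + 1)))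
    (hr : ∀ k ≤ n, partitionFn w d l (o + 1) k ≠ 0 → partitionFn w d l (o + 1) (k + 1) ≠ 0 →
      RelCoupled (Grow d) (law w d l (o + 1) k) (law w d l (o + 1) (k + 1))) :
    RelCoupled (Grow d) (law w d (l + 1) o n) (law w d (l + 1) o (n + 1)) := by
  have hu := treeWeight_nonneg (d := d) hw
  have hv := partitionFn_nonneg (d := d) hw l (o + 1)
  have hpos : ∀ N, partitionFn w d (l + 1) o N ≠ 0 → 0 < ∑ p ∈ antidiagonal N,
      treeWeight w d p.1 * partitionFn w d l (o + 1) p.2 := fun N hN => by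
    rw [← partitionFn_succ]
    exact (partitionFn_nonneg hw _ _ _).lt_of_ne' hN
  have hne : ∀ {N i}, partitionFn w d (l + 1) o N ≠ 0 →
      i ∈ (splitPMF (treeWeight w d) (partitionFn w d l (o + 1)) N).support →
      i ≤ N ∧ treeWeight w d i ≠ 0 ∧ partitionFn w d l (o + 1) (N - i) ≠ 0 := by
    intro N i hN hi
    have hle := le_of_mem_support_splitPMF hi
    rw [PMF.mem_support_iff, splitPMF_apply hu hv (hpos N hN), if_pos hle] at hi
    refine ⟨hle, ?_, ?_⟩ <;> intro h0 <;> simp [h0] at hi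
  obtain ⟨κ, hκ1, hκ2⟩ := exists_split_coupling hu hv (hpos n hZ) (hpos (n + 1) hZ')
    (by simpa only [← partitionFn_succ] using h1) (by simpa only [← partitionFn_succ] using h2)
  have hsupp1 : ∀ x ∈ κ.support,
      x.1 ∈ (splitPMF (treeWeight w d) (partitionFn w d l (o + 1)) n).support := fun x hx => by
    rw [← hκ1, PMF.mem_support_map_iff]
    exact ⟨x, hx, rfl⟩
  have hsupp2 : ∀ x ∈ κ.support, (if x.2 then x.1 + 1 else x.1) ∈
      (splitPMF (treeWeight w d) (partitionFn w d l (o + 1)) (n + 1)).support := fun x hx => by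
    rw [← hκ2, PMF.mem_support_map_iff]
    exact ⟨x, hx, rfl⟩
  have hstep : ∀ x ∈ κ.support, ∃ ρ : PMF (PForest × PForest),
      ρ.map Prod.fst = ((law w d 0 0 x.1).bind fun t =>
        (law w d l (o + 1) (n - x.1)).map (cons t)) ∧
      ρ.map Prod.snd = ((law w d 0 0 (if x.2 then x.1 + 1 else x.1)).bind fun t =>
        (law w d l (o + 1) (n + 1 - (if x.2 then x.1 + 1 else x.1))).map (cons t)) ∧
      ∀ y ∈ ρ.support, Grow d y.1 y.2 := by
    rintro ⟨i, b⟩ hx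
    obtain ⟨hi, hti, hri⟩ := hne hZ (hsupp1 _ hx)
    obtain ⟨hi', hti', hri'⟩ := hne hZ' (hsupp2 _ hx)
    cases b with
    | true =>
      simp only [if_true] at hi' hti' hri' ⊢
      obtain ⟨ρ, hρ1, hρ2, hρ⟩ := ht i hi hti hti'
      refine ⟨ρ.bind fun x => (law w d l (o + 1) (n - i)).map fun r => (cons x.1 r, cons x.2 r),
        ?_, ?_, ?_⟩
      · rw [PMF.map_bind, ← hρ1, PMF.bind_map]
        simp only [PMF.map_comp]
        rfl
      · rw [PMF.map_bind, ← hρ2, PMF.bind_map, Nat.add_sub_add_right]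
        simp only [PMF.map_comp]
        rfl
      · intro y hy
        rw [PMF.mem_support_bind_iff] at hy
        obtain ⟨x, hx, hy⟩ := hy
        rw [PMF.mem_support_map_iff] at hy
        obtain ⟨r, _, rfl⟩ := hy
        exact Grow.left r (hρ x hx)
    | false =>
      simp only [Bool.false_eq_true, if_false] at hi' hti' hri' ⊢
      rw [show n + 1 - i = n - i + 1 by simp only at hi; omega] at hri' ⊢
      obtain ⟨ρ, hρ1, hρ2, hρ⟩ := hr (n - i) (Nat.sub_le n i) hri hri'
      refine ⟨(law w d 0 0 i).bind fun t => ρ.map fun x => (cons t x.1, cons t x.2), ?_, ?_, ?_⟩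
      · rw [PMF.map_bind, ← hρ1]
        simp only [PMF.map_comp]
        rfl
      · rw [PMF.map_bind, ← hρ2]
        simp only [PMF.map_comp]
        rfl
      · intro y hy
        rw [PMF.mem_support_bind_iff] at hy
        obtain ⟨t, _, hy⟩ := hy
        rw [PMF.mem_support_map_iff] at hy
        obtain ⟨x, hx, rfl⟩ := hy
        exact Grow.right t (hρ x hx)
  have : Nonempty (PMF (PForest × PForest)) := ⟨PMF.pure (nil, nil)⟩
  choose! ρ hρ1 hρ2 hρ using hstep
  refine ⟨κ.bind ρ, ?_, ?_, ?_⟩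
  · rw [PMF.map_bind, PMF.bind_congr_support κ hρ1, law_succ, ← hκ1, PMF.bind_map]
    rfl
  · rw [PMF.map_bind, PMF.bind_congr_support κ hρ2, law_succ, ← hκ2, PMF.bind_map]
    rfl
  · intro y hy
    rw [PMF.mem_support_bind_iff] at hy
    obtain ⟨x, hx, hy⟩ := hy
    exact hρ x hx y hy

theorem ratioDecreasing_arithmetic (hsupp : ∀ k, w k ≠ 0 → d ∣ k)
    (hlc : RatioDecreasing fun k => w (k * d)) (s : ℕ) :
    RatioDecreasing fun e => w (s + e * d) := by
  by_cases hs : d ∣ s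
  · obtain ⟨j, rfl⟩ := hs
    have := hlc.shift j
    simpa only [mul_comm d j, ← add_mul] using this
  · have h0 : ∀ e, w (s + e * d) = 0 := fun e => by
      by_contra h
      exact hs ((Nat.dvd_add_left (Dvd.intro_left e rfl)).1 (hsupp _ h))
    intro i j k _
    simp [h0]

/-- The laws of random forests of consecutive sizes can be coupled by adding a bouquet. -/
theorem relCoupled_law (hd : 1 ≤ d) (hw : ∀ k, 0 ≤ w k) (hsupp : ∀ k, w k ≠ 0 → d ∣ k)
    (hlc : RatioDecreasing fun k => w (k * d)) (l o n : ℕ) :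
    partitionFn w d l o n ≠ 0 → partitionFn w d l o (n + 1) ≠ 0 →
      RelCoupled (Grow d) (law w d l o n) (law w d l o (n + 1)) := by
  refine law_induction d (P := fun l o n => partitionFn w d l o n ≠ 0 →
    partitionFn w d l o (n + 1) ≠ 0 →
      RelCoupled (Grow d) (law w d l o n) (law w d l o (n + 1))) ?_ ?_ ?_ l o n
  -- The only place where leaves are created: they follow all the existing children of the current
  -- vertex.
  · intro o _ _
    rw [law_zero_succ, law_size_zero, law_size_zero]
    refine ⟨PMF.pure (nil, leaves d), PMF.pure_map _ _, PMF.pure_map _ _, fun x hx => ?_⟩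
    obtain rfl := (PMF.mem_support_pure_iff _ _).1 hx
    exact Grow.nil
  · intro o n ih
    rw [law_zero_succ, law_zero_succ, partitionFn_zero_succ, partitionFn_zero_succ]
    exact ih
  · intro l o n ih0 ih hZ hZ'
    refine relCoupled_law_succ hw hZ hZ' (fun j => ?_) (fun j => ?_) (fun i hi => ?_) ih
    · have := tail_forestWeight_mono hd hlc (fun _ => hw _)
        (ratioDecreasing_arithmetic hsupp hlc (o + (l + 1))) (fun _ => hw _) l j n
      simpa only [treeWeight, partitionFn, show o + 1 + l = o + (l + 1) by ring] using this
    · have := tail_mixedWeight_mono hd hlc (fun _ => hw _)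
        (α := fun e => w (o + (l + 1) + e * d)) (fun _ => hw _) l j n
      rw [← Finset.Nat.sum_antidiagonal_swap, ← Finset.Nat.sum_antidiagonal_swap (n := n + 1)]
      simpa only [treeWeight, partitionFn, show o + 1 + l = o + (l + 1) by ring, Prod.fst_swap,
        Prod.snd_swap, mul_comm (forestWeight _ _ _ _)] using this
    · simpa only [partitionFn_zero_zero] using ih0 i hi

end Law

end PForest

/-! ### Forests as sets of words -/

namespace PForest

/-- The number of trees of the forest. -/
def length : PForest → ℕ
  | nil => 0
  | cons _ r => length r + 1

/-- The words of the vertices of the forest above a root, when the root has `o` other children to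
the left. -/
def words : PForest → ℕ → Finset (List ℕ+)
  | nil, _ => ∅
  | cons t r, o => (insert [] (words t 0)).image (List.cons o.succPNat) ∪ words r (o + 1)

theorem nil_notMem_words (c : PForest) (o : ℕ) : [] ∉ words c o := by
  induction c generalizing o with
  | nil => simp [words]
  | cons t r iht ihr => simp [words, ihr]

theorem cons_mem_words_cons (t r : PForest) (o : ℕ) (k : ℕ+) (v : List ℕ+) :
    k :: v ∈ words (cons t r) o ↔
      (k = o.succPNat ∧ (v = [] ∨ v ∈ words t 0)) ∨ k :: v ∈ words r (o + 1) := by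
  simp only [words, Finset.mem_union, Finset.mem_image, Finset.mem_insert, List.cons.injEq]
  constructor
  · rintro (⟨a, ha, rfl, rfl⟩ | h)
    exacts [Or.inl ⟨rfl, ha⟩, Or.inr h]
  · rintro (⟨rfl, h⟩ | h)
    exacts [Or.inl ⟨v, h, rfl, rfl⟩, Or.inr h]

theorem lt_of_cons_mem_words {c : PForest} {o : ℕ} {k : ℕ+} {v : List ℕ+}
    (h : k :: v ∈ words c o) : o < k := by
  induction c generalizing o with
  | nil => simp [words] at h
  | cons t r iht ihr =>
    rcases (cons_mem_words_cons t r o k v).1 h with ⟨rfl, _⟩ | h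
    · simp
    · have := ihr h
      omega

theorem succPNat_cons_mem_words_cons (t r : PForest) (o : ℕ) (v : List ℕ+) :
    o.succPNat :: v ∈ words (cons t r) o ↔ v = [] ∨ v ∈ words t 0 := by
  rw [cons_mem_words_cons]
  constructor
  · rintro (⟨_, h⟩ | h)
    · exact h
    · have := lt_of_cons_mem_words h
      simp at this
  · exact fun h => Or.inl ⟨rfl, h⟩

theorem cons_mem_words_cons_of_ne {t r : PForest} {o : ℕ} {k : ℕ+} {v : List ℕ+}
    (hk : k ≠ o.succPNat) : k :: v ∈ words (cons t r) o ↔ k :: v ∈ words r (o + 1) := by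
  rw [cons_mem_words_cons]
  simp [hk]

theorem singleton_mem_words (c : PForest) (o : ℕ) (k : ℕ+) :
    [k] ∈ words c o ↔ o < k ∧ (k : ℕ) ≤ o + length c := by
  induction c generalizing o with
  | nil => simp [words, length]
  | cons t r iht ihr =>
    rw [cons_mem_words_cons, ihr, length]
    have : k = o.succPNat ↔ (k : ℕ) = o + 1 := by
      rw [← PNat.coe_inj]; simp
    rw [this]
    simp only [true_or, and_true]
    omega

theorem mem_words_of_append (c : PForest) (o : ℕ) {u : List ℕ+} (hu : u ≠ []) {i : ℕ+}
    (h : u ++ [i] ∈ words c o) : u ∈ words c o ∧ ∀ j ≤ i, u ++ [j] ∈ words c o := by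
  induction c generalizing o u with
  | nil => simp [words] at h
  | cons t r iht ihr =>
    obtain ⟨k, v, rfl⟩ := List.exists_cons_of_ne_nil hu
    rw [List.cons_append] at h
    by_cases hk : k = o.succPNat
    · subst hk
      simp only [List.cons_append, succPNat_cons_mem_words_cons] at h ⊢
      replace h : v ++ [i] ∈ words t 0 := by simpa using h
      by_cases hv : v = []
      · subst hv
        refine ⟨Or.inl rfl, fun j hj => Or.inr ?_⟩
        rw [List.nil_append, singleton_mem_words] at h ⊢
        exact ⟨j.pos, (show (j : ℕ) ≤ i from hj).trans h.2⟩
      · obtain ⟨h1, h2⟩ := iht 0 hv h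
        exact ⟨Or.inr h1, fun j hj => Or.inr (h2 j hj)⟩
    · simp only [List.cons_append, cons_mem_words_cons_of_ne hk] at h ⊢
      exact ihr (o + 1) (by simp) h

/-- The plane tree with a given forest above its root. -/
def toPlaneTree (c : PForest) : PlaneTree where
  verts := insert [] (words c 0)
  nonempty := ⟨[], Finset.mem_insert_self _ _⟩
  closed := by
    intro u i h
    have h : u ++ [i] ∈ words c 0 := by simpa using h
    by_cases hu : u = []
    · subst hu
      refine ⟨Finset.mem_insert_self _ _, fun j hj => Finset.mem_insert_of_mem ?_⟩
      rw [List.nil_append, singleton_mem_words] at h ⊢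
      exact ⟨j.pos, (show (j : ℕ) ≤ i from hj).trans h.2⟩
    · obtain ⟨h1, h2⟩ := mem_words_of_append c 0 hu h
      exact ⟨Finset.mem_insert_of_mem h1, fun j hj => Finset.mem_insert_of_mem (h2 j hj)⟩

theorem words_cons_disjoint (t r : PForest) (o : ℕ) :
    Disjoint ((insert [] (words t 0)).image (List.cons o.succPNat)) (words r (o + 1)) := by
  rw [Finset.disjoint_left]
  intro x hx hx'
  obtain ⟨v, _, rfl⟩ := Finset.mem_image.1 hx
  have := lt_of_cons_mem_words hx'
  simp at this

theorem card_words (c : PForest) (o : ℕ) : (words c o).card = count c := by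
  induction c generalizing o with
  | nil => simp [words, count]
  | cons t r iht ihr =>
    rw [words, Finset.card_union_of_disjoint (words_cons_disjoint t r o),
      Finset.card_image_of_injective _ (List.cons_injective), Finset.card_insert_of_notMem
      (nil_notMem_words t 0), iht, ihr, count]
    ring

theorem size_toPlaneTree (c : PForest) : (toPlaneTree c).size = count c + 1 := by
  rw [PlaneTree.size, toPlaneTree, Finset.card_insert_of_notMem (nil_notMem_words c 0), card_words]

theorem ncard_pnat_le (m : ℕ) : {i : ℕ+ | (i : ℕ) ≤ m}.ncard = m := by
  have : {i : ℕ+ | (i : ℕ) ≤ m} = Nat.succPNat '' (Finset.range m : Set ℕ) := by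
    ext i
    simp only [Set.mem_ofPred_eq, Set.mem_image, Finset.coe_range, Set.mem_Iio]
    constructor
    · intro h
      exact ⟨i.natPred, by have := i.natPred_add_one; omega, by simp⟩
    · rintro ⟨k, hk, rfl⟩
      simpa using hk
  rw [this, Set.ncard_image_of_injective _ Nat.succPNat_injective, Set.ncard_coe_finset,
    Finset.card_range]

/-- The number of children of `u` among a set of words. -/
noncomputable def childCount (S : Finset (List ℕ+)) (u : List ℕ+) : ℕ :=
  {i : ℕ+ | u ++ [i] ∈ S}.ncard

theorem childCount_words_nil (c : PForest) : childCount (words c 0) [] = length c := by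
  rw [childCount, ← ncard_pnat_le (length c)]
  congr 1
  ext i
  simp [singleton_mem_words]

theorem numChildren_toPlaneTree (c : PForest) (u : List ℕ+) :
    (toPlaneTree c).numChildren u = childCount (words c 0) u := by
  simp [PlaneTree.numChildren, childCount, toPlaneTree]

/-- The extra factor is the weight of the parent, whose degree is known only at the end of its list
of children; this matches the offset in `rootWeight`. -/
theorem prod_words {w : ℕ → ℝ≥0∞} (wr : ℕ → ℝ) (hw : ∀ k, w k = ENNReal.ofReal (wr k))
    (hwr : ∀ k, 0 ≤ wr k) (c : PForest) (o : ℕ) :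
    (∏ u ∈ words c o, w (childCount (words c o) u)) * w (o + length c) =
      ENNReal.ofReal (rootWeight wr o c) := by
  induction c generalizing o with
  | nil => simp [words, length, rootWeight, hw]
  | cons t r iht ihr =>
    rw [rootWeight, ENNReal.ofReal_mul (rootWeight_nonneg hwr t 0), ← iht, ← ihr, length]
    nth_rewrite 1 [words]
    rw [Finset.prod_union (words_cons_disjoint t r o),
      Finset.prod_image (List.cons_injective.injOn),
      Finset.prod_insert (nil_notMem_words t 0)]
    have e0 : ∀ v, childCount (words (cons t r) o) (o.succPNat :: v) =
        childCount (words t 0) v := by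
      intro v
      simp [childCount, succPNat_cons_mem_words_cons]
    have e1 : ∀ u ∈ words r (o + 1), w (childCount (words (cons t r) o) u) =
        w (childCount (words r (o + 1)) u) := by
      intro u hu
      cases u with
      | nil => exact absurd hu (nil_notMem_words _ _)
      | cons k v =>
        have hk : k ≠ o.succPNat := by
          rintro rfl
          have := lt_of_cons_mem_words hu
          simp at this
        simp [childCount, cons_mem_words_cons_of_ne hk]
    rw [Finset.prod_congr rfl e1]
    simp only [e0, childCount_words_nil]
    rw [show o + 1 + length r = o + (length r + 1) by ring, zero_add]
    ring

theorem weight_toPlaneTree {w : ℕ → ℝ≥0∞} (wr : ℕ → ℝ) (hw : ∀ k, w k = ENNReal.ofReal (wr k))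
    (hwr : ∀ k, 0 ≤ wr k) (c : PForest) :
    PlaneTree.weight w (toPlaneTree c) = ENNReal.ofReal (rootWeight wr 0 c) := by
  rw [← prod_words wr hw hwr, PlaneTree.weight]
  simp only [numChildren_toPlaneTree]
  rw [toPlaneTree, Finset.prod_insert (nil_notMem_words c 0), childCount_words_nil, zero_add,
    mul_comm]

theorem words_injective {c c' : PForest} {o : ℕ} (h : words c o = words c' o) : c = c' := by
  induction c generalizing o c' with
  | nil =>
    cases c' with
    | nil => rfl
    | cons t' r' =>
      have : [o.succPNat] ∈ words (cons t' r') o :=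
        (succPNat_cons_mem_words_cons t' r' o []).2 (Or.inl rfl)
      rw [← h] at this
      simp [words] at this
  | cons t r iht ihr =>
    cases c' with
    | nil =>
      have : [o.succPNat] ∈ words (cons t r) o :=
        (succPNat_cons_mem_words_cons t r o []).2 (Or.inl rfl)
      rw [h] at this
      simp [words] at this
    | cons t' r' =>
      have ht : words t 0 = words t' 0 := by
        ext v
        by_cases hv : v = []
        · subst hv
          simp [nil_notMem_words]
        · have h1 := succPNat_cons_mem_words_cons t r o v
          rw [h, succPNat_cons_mem_words_cons] at h1
          simpa [hv] using h1.symm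
      have hr : words r (o + 1) = words r' (o + 1) := by
        ext v
        cases v with
        | nil => simp [nil_notMem_words]
        | cons k v =>
          by_cases hk : k = o.succPNat
          · subst hk
            have aux : ∀ s : PForest, o.succPNat :: v ∉ words s (o + 1) := fun s hs => by
              have := lt_of_cons_mem_words hs
              simp at this
            simp [aux]
          · rw [← cons_mem_words_cons_of_ne (t := t) hk, h, cons_mem_words_cons_of_ne hk]
      rw [iht ht, ihr hr]

theorem toPlaneTree_injective : Function.Injective toPlaneTree := by
  intro c c' h
  have h := congrArg PlaneTree.verts h
  refine words_injective (o := 0) ?_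
  simp only [toPlaneTree] at h
  rw [← Finset.erase_insert (nil_notMem_words c 0), h, Finset.erase_insert (nil_notMem_words c' 0)]

/-- Induction on the cardinality: the words starting with the letter `o + 1` give the first tree,
the other words the rest of the forest. -/
theorem exists_words_eq (S : Finset (List ℕ+)) (o : ℕ) (h0 : [] ∉ S)
    (h1 : ∀ k v, k :: v ∈ S → o < k)
    (h2 : ∀ u i, u ≠ [] → u ++ [i] ∈ S → u ∈ S ∧ ∀ j ≤ i, u ++ [j] ∈ S)
    (h3 : ∀ i j : ℕ+, o < j → j ≤ i → [i] ∈ S → [j] ∈ S) : ∃ c, words c o = S := by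
  induction hn : S.card using Nat.strong_induction_on generalizing S o with
  | _ n ih =>
    have hpre : ∀ v k, k :: v ∈ S → [k] ∈ S := by
      intro v
      induction v using List.reverseRecOn with
      | nil => exact fun k h => h
      | append_singleton v i ihv => exact fun k h => ihv k (h2 (k :: v) i (by simp) h).1
    by_cases hS : [o.succPNat] ∈ S
    · obtain ⟨t, ht⟩ := ih (S.preimage (List.cons o.succPNat) List.cons_injective.injOn |>.erase
        []).card (by
          rw [← hn, ← Finset.card_image_of_injective _ (List.cons_injective (a := o.succPNat))]
          refine Finset.card_lt_card ⟨fun u hu => ?_, fun hsub => ?_⟩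
          · obtain ⟨v, hv, rfl⟩ := Finset.mem_image.1 hu
            exact Finset.mem_preimage.1 (Finset.mem_of_mem_erase hv)
          · simpa using hsub hS) ((S.preimage (List.cons o.succPNat) List.cons_injective.injOn).erase []) 0
        (by simp) (fun k v _ => k.pos)
        (by
          intro u i hu h
          simp only [Finset.mem_erase, Finset.mem_preimage] at h ⊢
          obtain ⟨h4, h5⟩ := h2 (o.succPNat :: u) i (by simp) h.2
          exact ⟨⟨hu, h4⟩, fun j hj => ⟨by simp, h5 j hj⟩⟩)
        (by
          intro i j _ hj h
          simp only [Finset.mem_erase, Finset.mem_preimage] at h ⊢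
          exact ⟨by simp, (h2 [o.succPNat] i (by simp) h.2).2 j hj⟩) rfl
      obtain ⟨r, hr⟩ := ih (S.filter fun u => u.head? ≠ some o.succPNat).card
        (by
          rw [← hn]
          refine Finset.card_lt_card ⟨Finset.filter_subset _ _, fun hsub => ?_⟩
          simpa using hsub hS) (S.filter fun u => u.head? ≠ some o.succPNat) (o + 1)
        (by simp [h0])
        (by
          intro k v h
          simp only [Finset.mem_filter, List.head?_cons, ne_eq, Option.some.injEq] at h
          have h4 := h1 k v h.1
          have h5 : (k : ℕ) ≠ o + 1 := fun h5 => h.2 (PNat.coe_inj.1 (by simpa using h5))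
          omega)
        (by
          intro u i hu h
          obtain ⟨k, v, rfl⟩ := List.exists_cons_of_ne_nil hu
          simp only [Finset.mem_filter, List.cons_append, List.head?_cons] at h ⊢
          obtain ⟨h4, h5⟩ := h2 (k :: v) i (by simp) h.1
          exact ⟨⟨h4, h.2⟩, fun j hj => ⟨h5 j hj, h.2⟩⟩)
        (by
          intro i j ho hj h
          simp only [Finset.mem_filter, List.head?_cons, ne_eq, Option.some.injEq] at h ⊢
          refine ⟨h3 i j (by omega) hj h.1, ?_⟩
          rintro rfl
          simp at ho) rfl
      refine ⟨cons t r, ?_⟩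
      ext u
      cases u with
      | nil => simp [h0, nil_notMem_words]
      | cons k v =>
        rw [cons_mem_words_cons, ht, hr]
        simp only [Finset.mem_erase, Finset.mem_preimage, Finset.mem_filter, List.head?_cons,
          ne_eq, Option.some.injEq]
        by_cases hk : k = o.succPNat
        · subst hk
          by_cases hv : v = []
          · subst hv; simp [hS]
          · simp [hv]
        · simp [hk]
    · refine ⟨nil, ?_⟩
      rw [words]
      symm
      rw [Finset.eq_empty_iff_forall_notMem]
      intro u hu
      cases u with
      | nil => exact h0 hu
      | cons k v =>
        refine hS (h3 k _ (by simp) ?_ (hpre v k hu))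
        rw [← PNat.coe_le_coe]
        simpa using h1 k v hu

theorem toPlaneTree_surjective : Function.Surjective toPlaneTree := by
  intro T
  have hroot : ∀ v : List ℕ+, v ∈ T.verts → [] ∈ T.verts := by
    intro v
    induction v using List.reverseRecOn with
    | nil => exact id
    | append_singleton v i ihv => exact fun h => ihv (T.closed v i h).1
  have h0 : [] ∈ T.verts := hroot _ T.nonempty.choose_spec
  obtain ⟨c, hc⟩ := exists_words_eq (T.verts.erase []) 0 (by simp) (fun k _ _ => k.pos)
    (by
      intro u i hu h
      simp only [Finset.mem_erase] at h ⊢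
      obtain ⟨h1, h2⟩ := T.closed u i h.2
      exact ⟨⟨hu, h1⟩, fun j hj => ⟨by simp, h2 j hj⟩⟩)
    (by
      intro i j _ hj h
      simp only [Finset.mem_erase] at h ⊢
      exact ⟨by simp, (T.closed [] i h.2).2 j hj⟩)
  refine ⟨c, PlaneTree.ext ?_⟩
  change insert [] (words c 0) = T.verts
  rw [hc, Finset.insert_erase h0]

theorem mem_words_leaves (k o : ℕ) (v : List ℕ+) :
    v ∈ words (leaves k) o ↔ ∃ i : ℕ+, o < (i : ℕ) ∧ (i : ℕ) ≤ o + k ∧ v = [i] := by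
  induction k generalizing o with
  | zero =>
    simp only [leaves, words, Finset.notMem_empty, false_iff]
    rintro ⟨i, h1, h2, _⟩
    omega
  | succ k ih =>
    simp only [leaves, words, Finset.mem_union, ih, insert_empty_eq, Finset.image_singleton,
      Finset.mem_singleton]
    constructor
    · rintro (rfl | ⟨i, h1, h2, rfl⟩)
      · exact ⟨_, by simp, by simp, rfl⟩
      · exact ⟨i, by omega, by omega, rfl⟩
    · rintro ⟨i, h1, h2, rfl⟩
      by_cases hi : (i : ℕ) = o + 1
      · left
        congr 1
        exact PNat.coe_inj.1 (by simpa using hi)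
      · exact Or.inr ⟨i, by omega, by omega, rfl⟩

/-- The vertex `u` receives the bouquet and `k` is its previous number of children. Only an upper
bound on the old children is carried along; closure of the new tree under left siblings later gives
the exact count. -/
theorem Grow.words {d : ℕ} {c c' : PForest} (h : Grow d c c') (o : ℕ) :
    ∃ (u : List ℕ+) (k : ℕ), (u = [] ∧ o ≤ k ∨ u ∈ words c o) ∧
      (∀ i : ℕ+, u ++ [i] ∈ words c o → (i : ℕ) ≤ k) ∧
      ∀ v, v ∈ words c' o ↔
        v ∈ words c o ∨ ∃ i : ℕ+, k < (i : ℕ) ∧ (i : ℕ) ≤ k + d ∧ v = u ++ [i] := by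
  induction h generalizing o with
  | nil =>
    exact ⟨[], o, Or.inl ⟨rfl, le_rfl⟩, by simp [PForest.words], fun v => by
      simp [mem_words_leaves, PForest.words]⟩
  | @left t t' r h ih =>
    obtain ⟨u, k, hu, hk, hv⟩ := ih 0
    refine ⟨o.succPNat :: u, k, Or.inr ?_, ?_, ?_⟩
    · rw [succPNat_cons_mem_words_cons]; exact hu.imp_left And.left
    · intro i hi
      rw [List.cons_append, succPNat_cons_mem_words_cons] at hi
      exact hk i (by simpa using hi)
    · intro v
      cases v with
      | nil => simp [nil_notMem_words]
      | cons q v =>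
        by_cases hq : q = o.succPNat
        · subst hq
          rw [succPNat_cons_mem_words_cons, succPNat_cons_mem_words_cons, hv, or_assoc]
          simp
        · rw [cons_mem_words_cons_of_ne hq, cons_mem_words_cons_of_ne hq]
          simp [hq]
  | @right t r r' h ih =>
    obtain ⟨u, k, hu, hk, hv⟩ := ih (o + 1)
    have hne : ∀ (q : ℕ+) (v : List ℕ+), u = q :: v → q ≠ o.succPNat := by
      rintro q v rfl rfl
      have := lt_of_cons_mem_words (hu.resolve_left (by simp))
      simp at this
    refine ⟨u, k, ?_, ?_, ?_⟩
    · rcases hu with ⟨rfl, hu⟩ | hu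
      · exact Or.inl ⟨rfl, by omega⟩
      · exact Or.inr (Finset.mem_union_right _ hu)
    · intro i hi
      cases hu' : u with
      | nil =>
        subst hu'
        have ho : o + 1 ≤ k := by
          rcases hu with ⟨_, hu⟩ | hu
          exacts [hu, absurd hu (nil_notMem_words _ _)]
        rw [List.nil_append] at hi
        by_cases hq : i = o.succPNat
        · subst hq; simpa using ho
        · exact hk i ((cons_mem_words_cons_of_ne hq).1 hi)
      | cons q v =>
        subst hu'
        exact hk i ((cons_mem_words_cons_of_ne (hne q v rfl)).1 hi)
    · intro v
      rw [PForest.words, PForest.words, Finset.mem_union, Finset.mem_union, hv, or_assoc]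

theorem Grow.isRightLeaningBouquet {d : ℕ} (hd : 1 ≤ d) {c c' : PForest} (h : Grow d c c') :
    (toPlaneTree c).verts ⊂ (toPlaneTree c').verts ∧
      (toPlaneTree c').IsRightLeaningBouquet d
        (((toPlaneTree c').verts : Set (List ℕ+)) \ ((toPlaneTree c).verts : Set (List ℕ+))) := by
  obtain ⟨u, k, hu, hk, hv⟩ := h.words 0
  have hu' : u ∈ (toPlaneTree c).verts := by
    rcases hu with ⟨rfl, _⟩ | hu
    exacts [Finset.mem_insert_self _ _, Finset.mem_insert_of_mem hu]
  have hk' : ∀ i : ℕ+, u ++ [i] ∈ (toPlaneTree c).verts → (i : ℕ) ≤ k := fun i hi =>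
    hk i (by simpa [toPlaneTree] using hi)
  have hv' : ∀ v, v ∈ (toPlaneTree c').verts ↔ v ∈ (toPlaneTree c).verts ∨
      ∃ i : ℕ+, k < (i : ℕ) ∧ (i : ℕ) ≤ k + d ∧ v = u ++ [i] := fun v => by
    simp only [toPlaneTree, Finset.mem_insert, hv, or_assoc]
  generalize toPlaneTree c = T at *
  generalize toPlaneTree c' = T' at *
  have hsub : T.verts ⊆ T'.verts := fun v hv => (hv' v).2 (Or.inl hv)
  have hnum : T'.numChildren u = k + d := by
    rw [PlaneTree.numChildren, ← ncard_pnat_le (k + d)]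
    congr 1
    ext i
    simp only [Set.mem_ofPred_eq]
    constructor
    · intro hi
      rcases (hv' _).1 hi with hi | ⟨j, _, hj, he⟩
      · have := hk' i hi
        omega
      · obtain rfl : i = j := by simpa using he
        exact hj
    · intro hi
      refine (T'.closed u ⟨k + d, by omega⟩ ((hv' _).2 (Or.inr ⟨_, ?_, ?_, rfl⟩))).2 i hi
      · simp only [PNat.mk_coe]; omega
      · simp
  have hdiff : ∀ v, v ∈ ((T'.verts : Set (List ℕ+)) \ (T.verts : Set (List ℕ+))) ↔
      ∃ i : ℕ+, k < (i : ℕ) ∧ (i : ℕ) ≤ k + d ∧ v = u ++ [i] := by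
    intro v
    simp only [Set.mem_sdiff, Finset.mem_coe, hv']
    constructor
    · rintro ⟨h1 | h1, h2⟩
      exacts [absurd h1 h2, h1]
    · rintro ⟨i, h1, h2, rfl⟩
      refine ⟨Or.inr ⟨i, h1, h2, rfl⟩, fun h3 => ?_⟩
      have := hk' i h3
      omega
  refine ⟨⟨hsub, fun hsub' => ?_⟩, u, hsub hu', by omega, ?_, ?_⟩
  · have : u ++ [⟨k + 1, by omega⟩] ∈ ((T'.verts : Set (List ℕ+)) \ (T.verts : Set (List ℕ+))) :=
      (hdiff _).2 ⟨_, by simp, by simp only [PNat.mk_coe]; omega, rfl⟩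
    exact this.2 (hsub' this.1)
  · ext v
    rw [hdiff, hnum]
    simp
  · intro v hvd
    refine ⟨hvd.1, ?_⟩
    obtain ⟨i, h1, h2, rfl⟩ := (hdiff v).1 hvd
    rw [PlaneTree.numChildren]
    convert Set.ncard_empty ℕ+ using 2
    rw [Set.eq_empty_iff_forall_notMem]
    intro j hj
    rcases (hv' _).1 hj with hj | ⟨i', _, _, he⟩
    · exact hvd.2 (T.closed _ _ hj).1
    · have := congrArg List.length he
      simp at this

end PForest

/-! ### From consecutive couplings to a Markov chain -/

section MarkovChain

variable {S : Type} [Countable S] [MeasurableSpace S] [DiscreteMeasurableSpace S]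

/-- The transition kernels of a Markov chain as kernels depending on the whole past. -/
noncomputable def pastKernel (K : ℕ → S → PMF S) (n : ℕ) :
    Kernel ((i : Finset.Iic n) → (fun _ : ℕ => S) i) S :=
  (Kernel.ofFunOfCountable fun s => (K n s).toMeasure).comap
    (fun x => x ⟨n, Finset.mem_Iic.2 le_rfl⟩) (by fun_prop)

instance (K : ℕ → S → PMF S) (n : ℕ) : IsMarkovKernel (pastKernel K n) := by
  refine ⟨fun x => ?_⟩
  change IsProbabilityMeasure (K n _).toMeasure
  infer_instance

/-- The Ionescu-Tulcea construction, with kernels that read only the last coordinate. The event `B`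
on the past is arbitrary apart from its last value, which serves both for whole paths and for
one-time marginals. -/
theorem exists_markov_measure (p₀ : PMF S) (K : ℕ → S → PMF S) :
    ∃ P : Measure (ℕ → S), IsProbabilityMeasure P ∧ (∀ y, P {z | z 0 = y} = p₀ y) ∧
      ∀ (n : ℕ) (s y : S) (B : Set ((i : Finset.Iic n) → (fun _ : ℕ => S) i)), MeasurableSet B →
        (∀ b ∈ B, b ⟨n, Finset.mem_Iic.2 le_rfl⟩ = s) →
        P {z | Preorder.frestrictLe n z ∈ B ∧ z (n + 1) = y} =
          P {z | Preorder.frestrictLe n z ∈ B} * K n s y := by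
  set P := Kernel.trajMeasure (X := fun _ : ℕ => S) p₀.toMeasure (pastKernel K) with hP
  refine ⟨P, inferInstance, fun y => ?_, fun n s y B hB hs => ?_⟩
  · have h0 : P.map (Preorder.frestrictLe (π := fun _ : ℕ => S) 0) =
        p₀.toMeasure.map (MeasurableEquiv.piUnique _).symm := by
      rw [hP, Kernel.trajMeasure, Measure.map_comp _ _ (by fun_prop), Kernel.traj_map_frestrictLe,
        Kernel.partialTraj_self, Measure.id_comp]
    have h1 : P.map (fun z => z 0) = p₀.toMeasure := by
      have : (fun z : ℕ → S => z 0) = (fun b : (i : Finset.Iic 0) → (fun _ : ℕ => S) i =>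
          b ⟨0, Finset.mem_Iic.2 le_rfl⟩) ∘ Preorder.frestrictLe (π := fun _ : ℕ => S) 0 := rfl
      rw [this, ← Measure.map_map (by fun_prop) (by fun_prop), h0,
        Measure.map_map (by fun_prop) (by fun_prop)]
      exact Measure.map_id
    have h2 : {z : ℕ → S | z 0 = y} = (fun z => z 0) ⁻¹' {y} := rfl
    rw [h2, ← Measure.map_apply (measurable_pi_apply 0) (measurableSet_singleton y), h1,
      PMF.toMeasure_apply_singleton _ _ (measurableSet_singleton y)]
  · have h := Kernel.map_frestrictLe_trajMeasure_compProd_eq_map_trajMeasure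
      (X := fun _ : ℕ => S) (μ₀ := p₀.toMeasure) (κ := pastKernel K) (a := n)
    rw [← hP] at h
    have h' := congrArg (fun μ => μ (B ×ˢ {y})) h
    dsimp only at h'
    rw [Measure.compProd_apply_prod hB (measurableSet_singleton y),
      Measure.map_apply (by fun_prop) (hB.prod (measurableSet_singleton y))] at h'
    have h1 : {z : ℕ → S | Preorder.frestrictLe (π := fun _ : ℕ => S) n z ∈ B ∧
        z (n + 1) = y} =
        (fun x : ℕ → S => (Preorder.frestrictLe (π := fun _ : ℕ => S) n x, x (n + 1))) ⁻¹'
          (B ×ˢ {y}) := by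
      ext z
      simp
    rw [h1, ← h', setLIntegral_congr_fun (g := fun _ => K n s y) hB, setLIntegral_const, mul_comm,
      Measure.map_apply (by fun_prop) hB]
    · rfl
    · intro b hb
      change (K n (b ⟨n, _⟩)).toMeasure {y} = _
      rw [hs b hb, PMF.toMeasure_apply_singleton _ _ (measurableSet_singleton y)]

/-- Laws which can be coupled at consecutive times along a relation are the marginals of a Markov
chain whose trajectories follow the relation. -/
theorem exists_markovChain_of_relCoupled (p : ℕ → PMF S) (R : S → S → Prop)
    (h : ∀ n, RelCoupled R (p n) (p (n + 1))) :
    ∃ (P : Measure (ℕ → S)) (X : ℕ → (ℕ → S) → S), IsProbabilityMeasure P ∧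
      (∀ n, Measurable (X n)) ∧ (∀ n, P.map (X n) = (p n).toMeasure) ∧ IsMarkovChain P X ∧
      ∀ ω n, R (X n ω) (X (n + 1) ω) := by
  classical
  choose κ hκ1 hκ2 hκR using h
  have hrow : ∀ n s, ∑' y, κ n (s, y) = p n s := by
    intro n s
    symm
    rw [← hκ1 n, PMF.map_apply, ENNReal.tsum_prod', tsum_eq_single s]
    · simp
    · intro t ht
      simp [ht.symm]
  have hcol : ∀ n y, ∑' s, κ n (s, y) = p (n + 1) y := by
    intro n y
    rw [← hκ2 n, PMF.map_apply, ENNReal.tsum_prod']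
    refine tsum_congr fun s => ?_
    rw [tsum_eq_single y]
    · simp
    · intro t ht
      simp [ht.symm]
  -- The conditional law of the second coordinate of the coupling given the first; the choice is
  -- arbitrary at states of probability zero.
  have hK : ∀ n s, ∃ k : PMF S, ∀ y, p n s * k y = κ n (s, y) := by
    intro n s
    by_cases h0 : p n s = 0
    · refine ⟨PMF.pure s, fun y => ?_⟩
      rw [h0, zero_mul]
      exact (ENNReal.tsum_eq_zero.1 ((hrow n s).trans h0) y).symm
    · refine ⟨PMF.normalize (fun y => κ n (s, y)) (by rwa [hrow])
        (by rw [hrow]; exact (p n).apply_ne_top s), fun y => ?_⟩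
      rw [PMF.normalize_apply, hrow, mul_comm, mul_assoc,
        ENNReal.inv_mul_cancel h0 ((p n).apply_ne_top s), mul_one]
  choose K hK using hK
  obtain ⟨P, hP, hP0, hstep⟩ := exists_markov_measure (p 0) K
  have hone : ∀ n s y, P {z | z n = s ∧ z (n + 1) = y} = P {z | z n = s} * K n s y := fun n s y =>
    hstep n s y {b | b ⟨n, Finset.mem_Iic.2 le_rfl⟩ = s}
      (measurableSet_eq_fun (by fun_prop) measurable_const) fun b hb => hb
  have hpath : ∀ n (x : ℕ → S) y, P {z | (∀ i ≤ n, z i = x i) ∧ z (n + 1) = y} =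
      P {z | ∀ i ≤ n, z i = x i} * K n (x n) y := by
    intro n x y
    have := hstep n (x n) y {b | ∀ i : Finset.Iic n, b i = x i}
      (by
        rw [Set.ofPred_forall]
        exact MeasurableSet.iInter fun i =>
          measurableSet_eq_fun (by fun_prop) measurable_const) fun b hb => hb _
    simpa [Preorder.frestrictLe] using this
  have hlaw : ∀ n y, P {z | z n = y} = p n y := by
    intro n
    induction n with
    | zero => exact hP0
    | succ n ih =>
      intro y
      have e1 : {z : ℕ → S | z (n + 1) = y} = ⋃ s, {z | z n = s ∧ z (n + 1) = y} := by
        ext z; simp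
      rw [e1, measure_iUnion, ← hcol]
      · exact tsum_congr fun s => by rw [hone, ih, hK]
      · intro s t hst
        rw [Function.onFun, Set.disjoint_left]
        rintro z ⟨h1, _⟩ ⟨h2, _⟩
        exact hst (h1.symm.trans h2)
      · intro s
        exact (measurableSet_eq_fun (measurable_pi_apply n) measurable_const).inter
          (measurableSet_eq_fun (measurable_pi_apply (n + 1)) measurable_const)
  set G : Set (ℕ → S) := {z | ∀ n, R (z n) (z (n + 1))} with hG
  have hGm : MeasurableSet G := by
    rw [hG, Set.ofPred_forall]
    refine MeasurableSet.iInter fun n => ?_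
    exact measurableSet_preimage (f := fun z : ℕ → S => (z n, z (n + 1))) (by fun_prop)
      (MeasurableSet.of_discrete (s := {x : S × S | R x.1 x.2}))
  have hGae : ∀ᵐ z ∂P, z ∈ G := by
    simp only [hG, Set.mem_ofPred_eq]
    rw [ae_all_iff]
    intro n
    have e1 : {z : ℕ → S | ¬R (z n) (z (n + 1))} ⊆
        ⋃ x : {x : S × S // ¬R x.1 x.2}, {z | z n = x.1.1 ∧ z (n + 1) = x.1.2} := fun z hz =>
      Set.mem_iUnion.2 ⟨⟨(z n, z (n + 1)), hz⟩, rfl, rfl⟩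
    refine measure_mono_null e1 (measure_iUnion_null ?_)
    rintro ⟨⟨s, y⟩, hx⟩
    rw [hone, hlaw, hK, PMF.apply_eq_zero_iff]
    exact fun hmem => hx (hκR n _ hmem)
  obtain ⟨z₀, hz₀⟩ : G.Nonempty := by
    by_contra hne
    rw [Set.not_nonempty_iff_eq_empty] at hne
    simp only [hne, Set.mem_empty_iff_false, Filter.eventually_false_iff_eq_bot, ae_eq_bot] at hGae
    exact IsProbabilityMeasure.ne_zero P hGae
  -- On the null set where the relation fails somewhere, the path is replaced by a fixed good one,
  -- so that the relation holds for every `ω`.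
  set X : ℕ → (ℕ → S) → S := fun n z => if z ∈ G then z n else z₀ n with hX
  have hXm : ∀ n, Measurable (X n) := fun n =>
    Measurable.ite hGm (measurable_pi_apply n) measurable_const
  have hXae : ∀ᵐ z ∂P, ∀ n, X n z = z n := by
    filter_upwards [hGae] with z hz n
    simp [hX, hz]
  have hcongr : ∀ Q : (ℕ → S) → Prop, P {ω | Q fun n => X n ω} = P {z | Q z} := by
    intro Q
    refine measure_congr ?_
    filter_upwards [hXae] with z hz
    have : (fun n => X n z) = z := funext hz
    change (Q fun n => X n z) = Q z
    rw [this]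
  refine ⟨P, X, hP, hXm, fun n => ?_, fun n x y hne => ?_, fun ω n => ?_⟩
  · refine Measure.ext_of_singleton fun y => ?_
    rw [Measure.map_apply (hXm n) (measurableSet_singleton y),
      PMF.toMeasure_apply_singleton _ _ (measurableSet_singleton y), ← hlaw]
    exact hcongr fun z => z n = y
  · have m1 : MeasurableSet {ω | ∀ i ≤ n, X i ω = x i} := by
      simp only [Set.ofPred_forall]
      exact MeasurableSet.iInter fun i => MeasurableSet.iInter fun _ =>
        hXm i (measurableSet_singleton (x i))
    have m2 : MeasurableSet {ω | X n ω = x n} := hXm n (measurableSet_singleton (x n))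
    have hne' : P {ω | X n ω = x n} ≠ 0 := fun h0 =>
      hne (measure_mono_null (fun ω hω => hω n le_rfl) h0)
    have e1 : P ({ω | ∀ i ≤ n, X i ω = x i} ∩ {ω | X (n + 1) ω = y}) =
        P {ω | ∀ i ≤ n, X i ω = x i} * K n (x n) y := by
      rw [hcongr fun z => ∀ i ≤ n, z i = x i, ← hpath]
      exact hcongr fun z => (∀ i ≤ n, z i = x i) ∧ z (n + 1) = y
    have e2 : P ({ω | X n ω = x n} ∩ {ω | X (n + 1) ω = y}) =
        P {ω | X n ω = x n} * K n (x n) y := by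
      rw [hcongr fun z => z n = x n, ← hone]
      exact hcongr fun z => z n = x n ∧ z (n + 1) = y
    rw [cond_apply m1, cond_apply m2, e1, e2, ← mul_assoc, ← mul_assoc,
      ENNReal.inv_mul_cancel hne (measure_ne_top P _),
      ENNReal.inv_mul_cancel hne' (measure_ne_top P _)]
  · by_cases hω : ω ∈ G
    · simpa [hX, hω] using hω n
    · simpa [hX, hω] using hz₀ n

end MarkovChain

theorem RelCoupled.map {α β : Type*} {R : α → α → Prop} {R' : β → β → Prop} {p q : PMF α}
    (h : RelCoupled R p q) (f : α → β) (hf : ∀ x y, R x y → R' (f x) (f y)) :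
    RelCoupled R' (p.map f) (q.map f) := by
  obtain ⟨κ, h1, h2, h3⟩ := h
  refine ⟨κ.map (Prod.map f f), ?_, ?_, ?_⟩
  · rw [PMF.map_comp, ← h1, PMF.map_comp]
    rfl
  · rw [PMF.map_comp, ← h2, PMF.map_comp]
    rfl
  · intro y hy
    obtain ⟨x, hx, rfl⟩ := (PMF.mem_support_map_iff _ _ _).1 hy
    exact hf _ _ (h3 x hx)

/-! ### Identification of the conditioned tree laws -/

namespace PlaneTree

instance : DiscreteMeasurableSpace PlaneTree := ⟨fun _ => trivial⟩

instance : Countable PlaneTree :=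
  Function.Injective.countable (f := PlaneTree.verts) fun _ _ h => PlaneTree.ext h

theorem weightMeasure_singleton (w : ℕ → ℝ≥0∞) (T : PlaneTree) :
    weightMeasure w {T} = weight w T := by
  rw [weightMeasure, Measure.sum_apply _ (measurableSet_singleton T), tsum_eq_single T]
  · simp
  · intro T' hT'
    simp [hT']

theorem weightMeasure_restrict_singleton (w : ℕ → ℝ≥0∞) (n : ℕ) (T : PlaneTree) :
    (weightMeasure w).restrict {T | T.size = n} {T} = if T.size = n then weight w T else 0 := by
  rw [Measure.restrict_apply (measurableSet_singleton T)]
  split_ifs with h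
  · rw [Set.inter_eq_left.2 (by simpa using h), weightMeasure_singleton]
  · rw [Set.singleton_inter_eq_empty.2 (by simpa using h), measure_empty]

/-- Trees correspond bijectively to the forests above their roots, and the total weight of the trees
with `n * d + 1` vertices is the partition function, which cancels in the conditioning. -/
theorem simplyGenerated_eq_toMeasure {d : ℕ} (hd : 1 ≤ d) (w : ℕ → ℝ≥0)
    (hsupp : ∀ k, w k ≠ 0 → d ∣ k) (n : ℕ)
    (hZ : PForest.partitionFn (fun k => (w k : ℝ)) d 0 0 n ≠ 0) :
    simplyGenerated w (n * d + 1) =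
      ((PForest.law (fun k => (w k : ℝ)) d 0 0 n).map PForest.toPlaneTree).toMeasure := by
  set wr : ℕ → ℝ := fun k => (w k : ℝ) with hwr
  have hw0 : ∀ k, 0 ≤ wr k := fun k => (w k).2
  set p := (PForest.law wr d 0 0 n).map PForest.toPlaneTree with hp
  set z := ENNReal.ofReal (PForest.partitionFn wr d 0 0 n) with hz
  have hz0 : z ≠ 0 := by
    rw [hz, ne_eq, ENNReal.ofReal_eq_zero, not_le]
    exact (PForest.partitionFn_nonneg hw0 0 0 n).lt_of_ne' hZ
  have hztop : z ≠ ∞ := ENNReal.ofReal_ne_top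
  have hres : (weightMeasure fun k => (w k : ℝ≥0∞)).restrict {T | T.size = n * d + 1} =
      z • p.toMeasure := by
    refine Measure.ext_of_singleton fun T => ?_
    rw [weightMeasure_restrict_singleton, Measure.smul_apply,
      PMF.toMeasure_apply_singleton _ _ (measurableSet_singleton T), smul_eq_mul]
    obtain ⟨c, rfl⟩ := PForest.toPlaneTree_surjective T
    have hpc : p (PForest.toPlaneTree c) = PForest.law wr d 0 0 n c := by
      rw [hp, PMF.map_apply, tsum_eq_single c]
      · simp
      · intro c' hc'
        rw [if_neg]
        exact fun h => hc' (PForest.toPlaneTree_injective h).symm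
    rw [hpc, mul_comm z, PForest.law_apply_mul hd hw0 (fun k hk => hsupp k (by simpa [hwr] using hk))
      0 0 n (Nat.zero_le d) c, PForest.size_toPlaneTree,
      PForest.weight_toPlaneTree wr (fun k => by simp [hwr]) hw0]
    simp
  have hA : (weightMeasure fun k => (w k : ℝ≥0∞)) {T | T.size = n * d + 1} = z := by
    rw [← Measure.restrict_apply_univ, hres, Measure.smul_apply, measure_univ, smul_eq_mul, mul_one]
  rw [simplyGenerated, ProbabilityTheory.cond, hA, hres, smul_smul,
    ENNReal.inv_mul_cancel hz0 hztop, one_smul]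

theorem hasBouquetCoupling_simplyGenerated {d : ℕ} (hd : 1 ≤ d) (w : ℕ → ℝ≥0)
    (hsupp : ∀ k, w k ≠ 0 → d ∣ k) (h0 : w 0 ≠ 0) (h1 : w d ≠ 0)
    (hlc : IsLogConcaveSeq fun k => (w (k * d) : ℝ)) :
    HasBouquetCoupling d fun n => simplyGenerated w (n * d + 1) := by
  have hw0 : ∀ k, 0 ≤ (w k : ℝ) := fun k => (w k).2
  have hZ : ∀ n, PForest.partitionFn (fun k => (w k : ℝ)) d 0 0 n ≠ 0 := by
    intro n
    rw [PForest.partitionFn_zero_zero]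
    refine (forestWeight_pos hd (fun _ => hw0 _) ?_ ?_ Nat.one_pos n).ne'
    · simpa using pos_iff_ne_zero.2 h0
    · simpa using pos_iff_ne_zero.2 h1
  obtain ⟨P, X, hP, hX, hlaw, hM, hR⟩ := exists_markovChain_of_relCoupled
    (fun n => (PForest.law (fun k => (w k : ℝ)) d 0 0 n).map PForest.toPlaneTree)
    (fun T T' => T.verts ⊂ T'.verts ∧ T'.IsRightLeaningBouquet d
      ((T'.verts : Set (List ℕ+)) \ (T.verts : Set (List ℕ+))))
    fun n => (PForest.relCoupled_law hd hw0 (fun k hk => hsupp k (by simpa using hk))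
      hlc.ratioDecreasing 0 0 n (hZ n) (hZ (n + 1))).map PForest.toPlaneTree
        fun _ _ h => h.isRightLeaningBouquet hd
  refine ⟨ℕ → PlaneTree, inferInstance, P, X, hP, hX, fun n => ?_, hM, hR⟩
  dsimp only
  rw [hlaw, simplyGenerated_eq_toMeasure hd w hsupp n (hZ n)]

theorem bgwCond_eq_simplyGenerated (μ : Measure ℕ) [IsFiniteMeasure μ] (n : ℕ) :
    bgwCond μ n = simplyGenerated (fun k => (μ {k}).toNNReal) n := by
  have : (fun k => μ {k}) = fun k => ((μ {k}).toNNReal : ℝ≥0∞) :=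
    funext fun k => (ENNReal.coe_toNNReal (measure_ne_top μ _)).symm
  rw [bgwCond, bgw, this, simplyGenerated]

theorem hasBouquetCoupling_bgwCond {d : ℕ} (hd : 1 ≤ d) (μ : Measure ℕ) [IsProbabilityMeasure μ]
    (h0 : 0 < μ {0}) (h1 : μ {0} < 1) (hsupp : ∀ k, μ {k} ≠ 0 → d ∣ k)
    (hlc : IsLogConcaveSeq fun k => μ.real {k * d}) :
    HasBouquetCoupling d fun n => bgwCond μ (n * d + 1) := by
  have hne : ∀ k, (μ {k}).toNNReal ≠ 0 ↔ μ {k} ≠ 0 := fun k => by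
    simp [ENNReal.toNNReal_eq_zero_iff, measure_ne_top]
  simp only [bgwCond_eq_simplyGenerated]
  refine hasBouquetCoupling_simplyGenerated hd _ (fun k hk => hsupp k ((hne k).1 hk))
    ((hne 0).2 h0.ne') ((hne d).2 ?_) hlc
  -- Since `μ {0} < 1` there is an atom at a positive multiple of `d`; the absence of internal zeros
  -- then yields `μ {d} ≠ 0`.
  obtain ⟨k, hk0, hk⟩ : ∃ k, k ≠ 0 ∧ μ {k} ≠ 0 := by
    by_contra! hall
    have huniv : μ Set.univ = ∑' k, μ {k} := by
      rw [← measure_iUnion (fun i j hij => by simpa using hij) fun k => measurableSet_singleton k,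
        Set.iUnion_of_singleton]
    rw [measure_univ, tsum_eq_single 0 hall] at huniv
    exact h1.ne huniv.symm
  obtain ⟨j, rfl⟩ := hsupp k hk
  have hj : 0 < j := Nat.pos_of_ne_zero fun h => hk0 (by simp [h])
  have hreal : ∀ k, μ.real {k} ≠ 0 ↔ μ {k} ≠ 0 := fun k => by
    simp [Measure.real, ENNReal.toReal_eq_zero_iff]
  have := hlc.2.2 0 j hj (mul_ne_zero ((hreal _).2 (by simpa using h0.ne'))
    ((hreal _).2 (by rwa [mul_comm j d]))) 1 (by omega) (by omega)
  simpa using (hreal _).1 this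

end PlaneTree

/-! ### Uniform complete `d`-ary trees -/

/-- The degrees of a tree sum to its number of non-root vertices, so a geometric weight depends on
the size only. -/
theorem PForest.rootWeight_geometric (A s : ℝ) (c : PForest) (o : ℕ) :
    PForest.rootWeight (fun k => A * s ^ k) o c =
      A ^ (c.count + 1) * s ^ (o + c.count) := by
  induction c generalizing o with
  | nil => simp [rootWeight, count]
  | cons t r iht ihr =>
    rw [rootWeight, iht, ihr, count]
    ring

section Dary

variable {d : ℕ}

theorem daryOffspring_singleton_zero (hd : 2 ≤ d) : daryOffspring d {0} = 1 - (d : ℝ≥0∞)⁻¹ := by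
  have : d ≠ 0 := by omega
  simp [daryOffspring, this]

theorem daryOffspring_singleton_self (hd : 2 ≤ d) : daryOffspring d {d} = (d : ℝ≥0∞)⁻¹ := by
  have : (0 : ℕ) ≠ d := by omega
  simp [daryOffspring, this]

theorem daryOffspring_singleton_of_ne {k : ℕ} (h0 : k ≠ 0) (hk : k ≠ d) :
    daryOffspring d {k} = 0 := by
  simp [daryOffspring, h0.symm, hk.symm]

theorem inv_natCast_le_one (hd : 2 ≤ d) : (d : ℝ≥0∞)⁻¹ ≤ 1 := by
  rw [ENNReal.inv_le_one]
  exact_mod_cast (by omega : 1 ≤ d)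

theorem inv_natCast_lt_one (hd : 2 ≤ d) : (d : ℝ≥0∞)⁻¹ < 1 := by
  rw [ENNReal.inv_lt_one]
  exact_mod_cast (by omega : 1 < d)

theorem isProbabilityMeasure_daryOffspring (hd : 2 ≤ d) :
    IsProbabilityMeasure (daryOffspring d) := by
  refine ⟨?_⟩
  simp only [daryOffspring, Measure.add_apply, Measure.smul_apply, measure_univ, smul_eq_mul,
    mul_one]
  exact tsub_add_cancel_of_le (inv_natCast_le_one hd)

/-- The weights of the `d`-ary offspring law are geometric on its support. -/
theorem exists_daryOffspring_geometric (hd : 2 ≤ d) : ∃ A s : ℝ, 0 < A ∧ 0 < s ∧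
    daryOffspring d {0} = ENNReal.ofReal (A * s ^ 0) ∧
    daryOffspring d {d} = ENNReal.ofReal (A * s ^ d) := by
  have hd2 : (2 : ℝ) ≤ d := by exact_mod_cast hd
  have hinv : ENNReal.ofReal ((d : ℝ)⁻¹) = (d : ℝ≥0∞)⁻¹ := by
    rw [ENNReal.ofReal_inv_of_pos (by linarith), ENNReal.ofReal_natCast]
  -- The value at `0` fixes `A = 1 - 1 / d`; then `A * s ^ d = 1 / d` forces `s ^ d = 1 / (d - 1)`.
  refine ⟨1 - (d : ℝ)⁻¹, ((d : ℝ) - 1)⁻¹ ^ ((d : ℝ)⁻¹), ?_, ?_, ?_, ?_⟩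
  · have : (d : ℝ)⁻¹ < 1 := inv_lt_one_of_one_lt₀ (by linarith)
    linarith
  · exact Real.rpow_pos_of_pos (inv_pos.2 (by linarith)) _
  · rw [daryOffspring_singleton_zero hd, pow_zero, mul_one,
      ENNReal.ofReal_sub _ (by positivity), hinv, ENNReal.ofReal_one]
  · rw [daryOffspring_singleton_self hd, Real.rpow_inv_natCast_pow (inv_nonneg.2 (by linarith))
      (by omega), ← hinv]
    congr 1
    have : (d : ℝ) - 1 ≠ 0 := by linarith
    field_simp

theorem weight_daryOffspring (hd : 2 ≤ d) (n : ℕ) : ∃ C : ℝ≥0∞, C ≠ 0 ∧ C ≠ ∞ ∧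
    ∀ T : PlaneTree, T.size = n → (T.IsCompleteDary d →
      PlaneTree.weight (fun k => daryOffspring d {k}) T = C) ∧
      (¬T.IsCompleteDary d → PlaneTree.weight (fun k => daryOffspring d {k}) T = 0) := by
  obtain ⟨A, s, hA, hs, h0, h1⟩ := exists_daryOffspring_geometric hd
  refine ⟨ENNReal.ofReal (A ^ n * s ^ (n - 1)), ?_, ENNReal.ofReal_ne_top,
    fun T hT => ⟨fun hc => ?_, fun hc => ?_⟩⟩
  · rw [ne_eq, ENNReal.ofReal_eq_zero, not_le]
    positivity
  · have e1 : PlaneTree.weight (fun k => daryOffspring d {k}) T =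
        PlaneTree.weight (fun k => ENNReal.ofReal (A * s ^ k)) T := by
      refine Finset.prod_congr rfl fun u hu => ?_
      rcases hc u hu with h | h
      · simp only [h, h1]
      · simp only [h, h0]
    obtain ⟨c, rfl⟩ := PForest.toPlaneTree_surjective T
    rw [PForest.size_toPlaneTree] at hT
    rw [e1, PForest.weight_toPlaneTree (fun k => A * s ^ k) (fun _ => rfl)
      (fun k => by positivity), PForest.rootWeight_geometric, zero_add, ← hT,
      Nat.add_sub_cancel]
  · simp only [PlaneTree.IsCompleteDary, not_forall, not_or] at hc
    obtain ⟨u, hu, h2, h3⟩ := hc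
    exact Finset.prod_eq_zero hu (daryOffspring_singleton_of_ne h3 h2)

/-- All complete `d`-ary trees with `n` vertices have the same weight and the other trees weight
zero; the common constant cancels in the conditioning. -/
theorem bgwCond_daryOffspring (hd : 2 ≤ d) (n : ℕ) :
    PlaneTree.bgwCond (daryOffspring d) n =
      uniformOn {T : PlaneTree | T.IsCompleteDary d ∧ T.size = n} := by
  obtain ⟨C, hC0, hCtop, hC⟩ := weight_daryOffspring hd n
  have hres : (PlaneTree.bgw (daryOffspring d)).restrict {T | T.size = n} =
      C • Measure.count.restrict {T : PlaneTree | T.IsCompleteDary d ∧ T.size = n} := by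
    refine Measure.ext_of_singleton fun T => ?_
    rw [PlaneTree.bgw, PlaneTree.weightMeasure_restrict_singleton, Measure.smul_apply,
      Measure.restrict_apply (measurableSet_singleton T), smul_eq_mul]
    by_cases hT : T.size = n
    · rw [if_pos hT]
      by_cases hc : T.IsCompleteDary d
      · rw [(hC T hT).1 hc, Set.inter_eq_left.2 (by simpa using ⟨hc, hT⟩), Measure.count_singleton,
          mul_one]
      · rw [(hC T hT).2 hc, Set.singleton_inter_eq_empty.2 (by simp [hc]), measure_empty,
          mul_zero]
    · rw [if_neg hT, Set.singleton_inter_eq_empty.2 (by simp [hT]), measure_empty, mul_zero]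
  have hA : PlaneTree.bgw (daryOffspring d) {T | T.size = n} =
      C * Measure.count {T : PlaneTree | T.IsCompleteDary d ∧ T.size = n} := by
    rw [← Measure.restrict_apply_univ, hres, Measure.smul_apply, Measure.restrict_apply_univ,
      smul_eq_mul]
  rw [PlaneTree.bgwCond, uniformOn, ProbabilityTheory.cond, ProbabilityTheory.cond, hA, hres,
    smul_smul, ENNReal.mul_inv (Or.inl hC0) (Or.inl hCtop), mul_right_comm,
    ENNReal.inv_mul_cancel hC0 hCtop, one_mul]

theorem isLogConcaveSeq_daryOffspring (hd : 2 ≤ d) :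
    IsLogConcaveSeq fun k => (daryOffspring d).real {k * d} := by
  have hz : ∀ k, 2 ≤ k → (daryOffspring d).real {k * d} = 0 := fun k hk => by
    rw [Measure.real, daryOffspring_singleton_of_ne, ENNReal.toReal_zero]
    · exact Nat.mul_ne_zero (by omega) (by omega)
    · intro h
      have := Nat.mul_le_mul_right d hk
      omega
  refine ⟨fun _ => measureReal_nonneg, fun i => ?_, fun i j hij hne k hik hkj => ?_⟩
  · dsimp only
    rw [hz (i + 2) (by omega), mul_zero]
    positivity
  · have hj : j < 2 := by
      by_contra hj
      exact hne (by dsimp only; rw [hz j (by omega), mul_zero])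
    have : k = i ∨ k = j := by omega
    rcases this with rfl | rfl
    exacts [left_ne_zero_of_mul hne, right_ne_zero_of_mul hne]

end Dary

theorem theorem2 (d : ℕ) (hd : 1 ≤ d) :
    -- conditioned Bienaymé–Galton–Watson trees
    (∀ (μ : Measure ℕ) [IsProbabilityMeasure μ], 0 < μ {0} → μ {0} < 1 →
      (∀ k, μ {k} ≠ 0 → d ∣ k) →
      IsLogConcaveSeq (fun k => μ.real {k * d}) →
      HasBouquetCoupling d (fun n => PlaneTree.bgwCond μ (n * d + 1))) ∧
    -- the equivalent form for simply generated trees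
    (∀ w : ℕ → ℝ≥0, IsArithmeticSeq d w → 0 < w 0 * w d →
      IsLogConcaveSeq (fun k => (w (k * d) : ℝ)) →
      HasBouquetCoupling d (fun n => PlaneTree.simplyGenerated w (n * d + 1))) ∧
    -- the special case of uniform complete `d`-ary trees
    (2 ≤ d →
      (∀ n, PlaneTree.bgwCond (daryOffspring d) (n * d + 1) =
        uniformOn {T : PlaneTree | T.IsCompleteDary d ∧ T.size = n * d + 1}) ∧
      HasBouquetCoupling d
        (fun n => uniformOn {T : PlaneTree | T.IsCompleteDary d ∧ T.size = n * d + 1})) := by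
  refine ⟨fun μ _ h0 h1 hsupp hlc => PlaneTree.hasBouquetCoupling_bgwCond hd μ h0 h1 hsupp hlc,
    fun w hw h0 hlc => ?_, fun hd2 => ⟨fun n => bgwCond_daryOffspring hd2 _, ?_⟩⟩
  · obtain ⟨r, _, hr⟩ := hw
    refine PlaneTree.hasBouquetCoupling_simplyGenerated hd w (fun k hk => ?_)
      (left_ne_zero_of_mul h0.ne') (right_ne_zero_of_mul h0.ne') hlc
    have hk : k ∈ Function.support w := hk
    rw [hr] at hk
    obtain ⟨l, _, rfl⟩ := hk
    exact Dvd.intro_left l rfl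
  · have := isProbabilityMeasure_daryOffspring hd2
    simp only [← bgwCond_daryOffspring hd2]
    refine PlaneTree.hasBouquetCoupling_bgwCond hd _ ?_ ?_ (fun k hk => ?_)
      (isLogConcaveSeq_daryOffspring hd2)
    · rw [daryOffspring_singleton_zero hd2]
      exact tsub_pos_of_lt (inv_natCast_lt_one hd2)
    · rw [daryOffspring_singleton_zero hd2]
      refine ENNReal.sub_lt_self ENNReal.one_ne_top one_ne_zero ?_
      simp
    · by_cases h0 : k = 0
      · simp [h0]
      · by_contra hkd
        exact hk (daryOffspring_singleton_of_ne h0 fun h => hkd (by rw [h]))
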